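/- Let $\mathcal G=(X,E)$ be a finite connected graph without loop-edges or multiple edges, with conductances $C_{x,y}=C_{y,x}\ge 0$ indexed by the edges ($C_{x,y}=0$ if $\{x,y\}\notin E$) and a killing measure $\kappa\ge 0$ on $X$, such that the energy $\mathcal E(f,f)=\frac12\sum_{x,y}C_{x,y}(f(x)-f(y))^2+\sum_x\kappa_x f(x)^2$ is positive definite. Put $\lambda_x=\sum_y C_{x,y}+\kappa_x$ and $P_{x,y}=C_{x,y}/\lambda_x$. Let $\mu=\sum_x\int_0^\infty P_t^{x,x}\,\frac{dt}{t}$ be the loop measure (considered on loops, i.e. up to the choice of the base point) of the continuous-time Markov process with transition matrix $P$ and independent exponential holding times of mean $1$, where $P_t^{x,x}$ is the non-normalized law of the process started at $x$, up to time $t$, restricted to the event that it is alive and at $x$ at time $t$. Let $\mathcal L_1$ be a Poisson process of loops of intensity $\mu$. Let $N^{(1)}_{x,y}$ be the total number of jumps from $x$ to $y$ made by the loops of $\mathcal L_1$, and $\hat{\mathcal L}_1^x$ the total time spent at $x$ by these loops divided by $\lambda_x$. Set $\check N^{(1)}_{x,y}=N^{(1)}_{x,y}-N^{(1)}_{y,x}$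 and $j(\check N^{(1)})_{x,y}=1_{\{\check N^{(1)}_{x,y}>0\}}\check N^{(1)}_{x,y}$. An Eulerian network is a matrix $k=(k_{x,y})$ with entries in $\mathbb N$, vanishing outside the oriented edges, with $\sum_y k_{x,y}=\sum_y k_{y,x}$ for all $x$; a flow is an Eulerian network $h$ with $h_{x,y}h_{y,x}=0$ for all edges $\{x,y\}$. Let $I_\nu(x)=\sum_{m\ge0}\frac{1}{m!\,\Gamma(\nu+m+1)}\left(\frac x2\right)^{2m+\nu}$ be the modified Bessel function (with $0^0=1$). **Theorem.** Almost surely, $N^{(1)}$ is a (finite-valued) Eulerian network and $\hat{\mathcal L}_1$ is finite. For every flow $h$, setting $h_{\{x,y\}}=\max(h_{x,y},h_{y,x})$, and for every Borel set $B\subseteq\mathbb R^X$, $$\mathbb P\big(j(\check N^{(1)})=h,\ \hat{\mathcal L}_1\in B\big)=\int_{B\cap[0,\infty)^X}\det(I-P)\prod_{\{x,y\}\in E}I_{h_{\{x,y\}}}\!\left(2\sqrt{\rho_x}\,C_{x,y}\sqrt{\rho_y}\right)\prod_{x\in X}\lambda_x e^{-\lambda_x\rho_x}\,d\rho_x .$$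 -/

import Mathlib

open MeasureTheory ProbabilityTheory
open scoped ENNReal NNReal

namespace LoopEnsemble

noncomputable section

/-! ### The weighted graph: energy, duality measure, transition matrix

Conductances are indexed by unordered pairs, `C s(x, y)` being `C_{x,y} = C_{y,x}`. -/

/-- `𝓔(f,f) = ½ ∑_{x,y} C_{x,y} (f x - f y)² + ∑_x κ_x (f x)²`. -/
def energy {X : Type*} [Fintype X] (C : Sym2 X → ℝ) (κ : X → ℝ) (f : X → ℝ) : ℝ :=
  1 / 2 * ∑ x, ∑ y, C s(x, y) * (f x - f y) ^ 2 + ∑ x, κ x * f x ^ 2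

/-- The duality measure `λ_x = ∑_y C_{x,y} + κ_x`. -/
def dualityMeasure {X : Type*} [Fintype X] (C : Sym2 X → ℝ) (κ : X → ℝ) (x : X) : ℝ :=
  ∑ y, C s(x, y) + κ x

/-- The submarkovian transition matrix: from `x`, jump to `y` with probability `C_{x,y} / λ_x`,
and die with the remaining probability `κ_x / λ_x`. -/
def transitionMatrix {X : Type*} [Fintype X] (C : Sym2 X → ℝ) (κ : X → ℝ) : Matrix X X ℝ :=
  Matrix.of fun x y => C s(x, y) / dualityMeasure C κ x

/-! ### Based loops and loops -/

/-- A discrete based loop in `G` with `n` jumps: the successive positions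
`pt 0, pt 1, …, pt n = pt 0`, each adjacent to the next one. -/
structure DiscreteLoop {X : Type*} (G : SimpleGraph X) where
  n : ℕ
  pt : Fin (n + 1) → X
  adj : ∀ i : Fin n, G.Adj (pt i.castSucc) (pt i.succ)
  closed : pt 0 = pt (Fin.last n)

/-- A based loop in continuous time: a discrete based loop together with the lengths of its
`n + 1` successive sojourns. It stands for the piecewise constant path on `[0, T]`,
`T = ∑ i, τ i`, that stays at `pt i` during a time `τ i`, for `i = 0, …, n` in this order. -/
def BasedLoop {X : Type*} (G : SimpleGraph X) : Type _ :=
  Σ d : DiscreteLoop G, Fin (d.n + 1) → Set.Ioi (0 : ℝ)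

/-- The space of based loops is a countable disjoint union of the spaces `(0, ∞)^(n+1)`. -/
instance {X : Type*} (G : SimpleGraph X) : MeasurableSpace (BasedLoop G) :=
  inferInstanceAs (MeasurableSpace (Σ d : DiscreteLoop G, Fin (d.n + 1) → Set.Ioi (0 : ℝ)))

namespace BasedLoop

variable {X : Type*} {G : SimpleGraph X}

/-- The periodic sequence (of period `n` if there are `n ≥ 1` jumps, constant if `n = 0`) of the
sites visited by the loop, when the loop is followed round and round. -/
def site (l : BasedLoop G) (m : ℕ) : X := l.1.pt (Fin.ofNat (l.1.n + 1) (m % l.1.n))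

/-- The lengths of the sojourns in the sites of the sequence `site`. When there are jumps, the
first and the last sojourn of the based loop take place at its base point, and they are one and
the same sojourn of the closed path. -/
def duration (l : BasedLoop G) (m : ℕ) : ℝ :=
  if l.1.n = 0 then (l.2 0 : ℝ)
  else if m % l.1.n = 0 then (l.2 0 : ℝ) + (l.2 (Fin.last l.1.n) : ℝ)
  else (l.2 (Fin.ofNat (l.1.n + 1) (m % l.1.n)) : ℝ)

/-- Two based loops are equivalent if they differ only by the choice of the base point, i.e. by
a translation of time along the closed path. -/
def Equivalent (l l' : BasedLoop G) : Prop :=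
  l.1.n = l'.1.n ∧
    ∃ k : ℕ, ∀ m, l'.site m = l.site (m + k) ∧ l'.duration m = l.duration (m + k)

/-- The number of jumps from `x` to `y`. -/
def jumps [DecidableEq X] (l : BasedLoop G) (x y : X) : ℕ :=
  ∑ i : Fin l.1.n, if l.1.pt i.castSucc = x ∧ l.1.pt i.succ = y then 1 else 0

/-- The total time spent in `x`. -/
def timeSpent [DecidableEq X] (l : BasedLoop G) (x : X) : ℝ :=
  ∑ i : Fin (l.1.n + 1), if l.1.pt i = x then (l.2 i : ℝ) else 0

theorem sum_range_shift {M : Type*} [AddCommMonoid M] (f : ℕ → M) (n : ℕ)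
    (hf : ∀ m, f (m + n) = f m) (k : ℕ) :
    ∑ m ∈ Finset.range n, f (m + k) = ∑ m ∈ Finset.range n, f m := by
  induction k with
  | zero => simp
  | succ k ih =>
    rw [← ih]
    have h3 : f (n + k) = f (0 + k) := by
      rw [zero_add, add_comm, hf]
    cases n with
    | zero => simp
    | succ n =>
      rw [Finset.sum_range_succ, Finset.sum_range_succ' (fun m => f (m + k))]
      have h4 : n + (k + 1) = n + 1 + k := by omega
      rw [h4, h3]
      congr 1
      refine Finset.sum_congr rfl fun m _ => ?_
      congr 1
      omega

theorem site_add (l : BasedLoop G) (m : ℕ) : l.site (m + l.1.n) = l.site m := by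
  simp [site]

theorem duration_add (l : BasedLoop G) (m : ℕ) : l.duration (m + l.1.n) = l.duration m := by
  simp [duration]

theorem site_zero_jumps (l : BasedLoop G) (h : l.1.n = 0) (m : ℕ) : l.site m = l.1.pt 0 := by
  obtain ⟨⟨n, pt, adj, closed⟩, τ⟩ := l
  dsimp only at h
  subst h
  simp only [site]
  congr 1
  exact Subsingleton.elim (α := Fin 1) _ _

theorem site_castSucc (l : BasedLoop G) (i : Fin l.1.n) : l.site i = l.1.pt i.castSucc := by
  simp only [site]
  congr 1
  ext
  have := i.2
  simp only [Fin.val_ofNat, Fin.val_castSucc, Nat.mod_eq_of_lt i.2]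
  exact Nat.mod_eq_of_lt (by omega)

theorem site_succ (l : BasedLoop G) (i : Fin l.1.n) : l.site (i + 1) = l.1.pt i.succ := by
  have hi := i.2
  by_cases h : (i : ℕ) + 1 = l.1.n
  · have h1 : i.succ = Fin.last l.1.n := by
      ext; simpa using h
    rw [h1, ← l.1.closed, h]
    simp only [site, Nat.mod_self]
    rfl
  · simp only [site]
    congr 1
    ext
    have h2 : (i : ℕ) + 1 < l.1.n := by omega
    simp only [Fin.val_ofNat, Fin.val_succ, Nat.mod_eq_of_lt h2]
    exact Nat.mod_eq_of_lt (by omega)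

theorem jumps_eq [DecidableEq X] (l : BasedLoop G) (x y : X) :
    l.jumps x y =
      ∑ m ∈ Finset.range l.1.n, if l.site m = x ∧ l.site (m + 1) = y then 1 else 0 := by
  rw [Finset.sum_range]
  simp only [site_castSucc, site_succ]
  rfl

theorem timeSpent_eq [DecidableEq X] (l : BasedLoop G) (x : X) :
    l.timeSpent x =
      if l.1.n = 0 then (if l.site 0 = x then l.duration 0 else 0)
      else ∑ m ∈ Finset.range l.1.n, if l.site m = x then l.duration m else 0 := by
  by_cases h : l.1.n = 0
  · rw [if_pos h, site_zero_jumps l h]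
    simp only [duration, if_pos h, timeSpent]
    obtain ⟨⟨n, pt, adj, closed⟩, τ⟩ := l
    dsimp only at h
    subst h
    simp
  · rw [if_neg h, Finset.sum_range, timeSpent]
    simp only [site_castSucc]
    obtain ⟨⟨n, pt, adj, closed⟩, τ⟩ := l
    dsimp only at h closed ⊢
    obtain ⟨k, rfl⟩ := Nat.exists_eq_succ_of_ne_zero h
    rw [Fin.sum_univ_castSucc, Fin.sum_univ_succ, Fin.sum_univ_succ (n := k)]
    have e0 : (BasedLoop.duration (G := G) ⟨⟨k + 1, pt, adj, closed⟩, τ⟩ ((0 : Fin (k + 1)) : ℕ))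
        = (τ 0 : ℝ) + (τ (Fin.last (k + 1)) : ℝ) := by
      simp [duration]
    have e1 : ∀ i : Fin k,
        (BasedLoop.duration (G := G) ⟨⟨k + 1, pt, adj, closed⟩, τ⟩ ((i.succ : Fin (k + 1)) : ℕ))
        = (τ i.succ.castSucc : ℝ) := by
      intro i
      have hi := i.2
      have h1 : ((i : ℕ) + 1) % (k + 1) = i + 1 := Nat.mod_eq_of_lt (by omega)
      simp only [duration, Fin.val_succ, h1]
      rw [if_neg (by omega), if_neg (by omega)]
      congr 2
      ext
      simp only [Fin.val_ofNat, Fin.val_castSucc, Fin.val_succ]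
      exact Nat.mod_eq_of_lt (by omega)
    simp only [e0, e1]
    simp only [← closed, Fin.castSucc_zero]
    by_cases hx : pt 0 = x
    · simp only [hx, if_true]
      ring
    · simp only [hx, if_false]
      ring

theorem jumps_congr [DecidableEq X] {l l' : BasedLoop G} (h : l.Equivalent l') :
    l.jumps = l'.jumps := by
  obtain ⟨hn, k, hk⟩ := h
  funext x y
  rw [jumps_eq, jumps_eq, ← hn]
  rw [← sum_range_shift (fun m => if l.site m = x ∧ l.site (m + 1) = y then 1 else 0) l.1.n
    (fun m => by
      have h1 : m + l.1.n + 1 = m + 1 + l.1.n := by omega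
      simp only [h1, site_add]) k]
  refine Finset.sum_congr rfl fun m _ => ?_
  have h1 : m + k + 1 = m + 1 + k := by omega
  simp only [h1, (hk m).1, (hk (m + 1)).1]

theorem timeSpent_congr [DecidableEq X] {l l' : BasedLoop G} (h : l.Equivalent l') :
    l.timeSpent = l'.timeSpent := by
  obtain ⟨hn, k, hk⟩ := h
  funext x
  rw [timeSpent_eq, timeSpent_eq, ← hn]
  by_cases h0 : l.1.n = 0
  · simp only [if_pos h0]
    rw [(hk 0).1, (hk 0).2, site_zero_jumps l h0, site_zero_jumps l h0]
    simp only [duration, if_pos h0]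
  · simp only [if_neg h0]
    rw [← sum_range_shift (fun m => if l.site m = x then l.duration m else 0) l.1.n
      (fun m => by simp only [site_add, duration_add]) k]
    refine Finset.sum_congr rfl fun m _ => ?_
    simp only [(hk m).1, (hk m).2]

end BasedLoop

/-- A loop is a based loop without its base point. As a quotient, this space carries the quotient
`σ`-algebra. -/
def Loop {X : Type*} (G : SimpleGraph X) : Type _ :=
  Quot (BasedLoop.Equivalent (G := G))

instance {X : Type*} (G : SimpleGraph X) : MeasurableSpace (Loop G) :=
  inferInstanceAs (MeasurableSpace (Quot (BasedLoop.Equivalent (G := G))))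

/-- The number of jumps of a loop from `x` to `y`. -/
def Loop.jumps {X : Type*} [DecidableEq X] {G : SimpleGraph X} (l : Loop G) : X → X → ℕ :=
  Quot.lift BasedLoop.jumps (fun _ _ h => BasedLoop.jumps_congr h) l

/-- The total time spent by a loop in `x`. -/
def Loop.timeSpent {X : Type*} [DecidableEq X] {G : SimpleGraph X} (l : Loop G) : X → ℝ :=
  Quot.lift BasedLoop.timeSpent (fun _ _ h => BasedLoop.timeSpent_congr h) l

/-! ### The loop measure -/

/-- The based loop measure `∑_x ∫_0^∞ P_t^{x,x} dt / t`, where `P_t^{x,x}` is the (non normalized)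
law of the Markov process with jump matrix `P` and independent exponential holding times of mean
`1`, started at `x`, up to time `t`, on the event that it is alive and at `x` at time `t`.
The part with `n` jumps and positions `ξ_0, …, ξ_n = ξ_0` has, in terms of the completed sojourns
`τ_0, …, τ_{n-1}` and of the last, incomplete one `τ_n = t - τ_0 - ⋯ - τ_{n-1}`, the density
`∏_{i<n} P_{ξ_i,ξ_{i+1}} e^{-τ_i} · e^{-τ_n} / t`, with `t = τ_0 + ⋯ + τ_n`. -/
def basedLoopMeasure {X : Type*} [Fintype X] (G : SimpleGraph X) (C : Sym2 X → ℝ) (κ : X → ℝ) :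
    Measure (BasedLoop G) :=
  Measure.sum fun d : DiscreteLoop G =>
    ((Measure.pi fun _ : Fin (d.n + 1) =>
        (volume : Measure ℝ).comap (Subtype.val : Set.Ioi (0 : ℝ) → ℝ)).withDensity fun τ =>
      ENNReal.ofReal
        ((∏ i : Fin d.n, transitionMatrix C κ (d.pt i.castSucc) (d.pt i.succ)) *
          Real.exp (-∑ i, (τ i : ℝ)) / ∑ i, (τ i : ℝ))).map (Sigma.mk d)

/-- The loop measure `μ`: the image of the based loop measure. -/
def loopMeasure {X : Type*} [Fintype X] (G : SimpleGraph X) (C : Sym2 X → ℝ) (κ : X → ℝ) :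
    Measure (Loop G) :=
  (basedLoopMeasure G C κ).map (Quot.mk _)

/-! ### Poisson processes and the Poissonian loop ensembles -/

/-- `L` is a Poisson point process on `E` with intensity `ν`. A countable set of points (with
multiplicities) is identified with the sum of the Dirac masses at these points. -/
structure IsPoissonProcess {Ω E : Type*} [MeasurableSpace Ω] [MeasurableSpace E]
    (L : Ω → Measure E) (ν : Measure E) (Pr : Measure Ω) : Prop where
  measurable : Measurable L
  point_process : ∀ᵐ ω ∂Pr, ∃ (S : Set ℕ) (p : S → E), L ω = Measure.sum fun i => Measure.dirac (p i)
  law : ∀ A : Set E, MeasurableSet A → ν A ≠ ∞ →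
    Pr.map (fun ω => L ω A) = (poissonMeasure (ν A).toNNReal).map (fun n : ℕ => (n : ℝ≥0∞))
  indep : ∀ (m : ℕ) (A : Fin m → Set E), (∀ i, MeasurableSet (A i)) →
    Pairwise (Function.onFun Disjoint A) → iIndepFun (fun i ω => L ω (A i)) Pr

/-- `L` is the Poissonian loop ensemble `𝓛_α`: the Poisson process of loops with intensity
`α μ`. -/
def IsPoissonianLoopEnsemble {X : Type*} [Fintype X] (G : SimpleGraph X) (C : Sym2 X → ℝ)
    (κ : X → ℝ) (α : ℝ≥0) {Ω : Type*} [MeasurableSpace Ω] (L : Ω → Measure (Loop G))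
    (Pr : Measure Ω) : Prop :=
  IsPoissonProcess L (α • loopMeasure G C κ) Pr

/-- The total number of jumps from `x` to `y` made by the loops of a set of loops, a priori
possibly infinite. -/
def totalJumps {X : Type*} [DecidableEq X] {G : SimpleGraph X} (L : Measure (Loop G))
    (x y : X) : ℝ≥0∞ :=
  ∫⁻ l, (l.jumps x y : ℝ≥0∞) ∂L

/-- The total number of jumps `N_{x,y}` as a natural number. It equals `totalJumps L x y` whenever
the latter is finite (the points of a point process being counted with integer multiplicities). -/
def network {X : Type*} [DecidableEq X] {G : SimpleGraph X} (L : Measure (Loop G))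
    (x y : X) : ℕ :=
  ⌊(totalJumps L x y).toReal⌋₊

/-- The occupation field: the total time spent in `x` by the loops of a set of loops, divided by
`λ_x`, a priori possibly infinite. -/
def occupationField {X : Type*} [Fintype X] [DecidableEq X] {G : SimpleGraph X} (C : Sym2 X → ℝ)
    (κ : X → ℝ) (L : Measure (Loop G)) (x : X) : ℝ≥0∞ :=
  (∫⁻ l, ENNReal.ofReal (l.timeSpent x) ∂L) / ENNReal.ofReal (dualityMeasure C κ x)

/-! ### Eulerian networks and flows -/

/-- An Eulerian network: an `ℕ`-valued function on oriented edges (extended by `0`) with as much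
going out of every vertex as coming in. -/
structure IsEulerian {X : Type*} [Fintype X] (G : SimpleGraph X) (k : X → X → ℕ) : Prop where
  eq_zero : ∀ x y, ¬ G.Adj x y → k x y = 0
  balance : ∀ x, ∑ y, k x y = ∑ y, k y x

/-- A flow: an Eulerian network using at most one of the two orientations of every edge. -/
structure IsFlow {X : Type*} [Fintype X] (G : SimpleGraph X) (j : X → X → ℕ) : Prop
    extends IsEulerian G j where
  oriented : ∀ x y, G.Adj x y → j x y * j y x = 0

/-- The antisymmetric part `ǩ_{x,y} = k_{x,y} - k_{y,x}` of a network. -/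
def antisymmPart {X : Type*} (k : X → X → ℕ) (x y : X) : ℤ := (k x y : ℤ) - (k y x : ℤ)

/-- The flow `j(a)_{x,y} = 1_{a_{x,y} > 0} a_{x,y}` induced by an antisymmetric integer matrix. -/
def inducedFlow {X : Type*} (a : X → X → ℤ) (x y : X) : ℕ :=
  if 0 < a x y then (a x y).toNat else 0

/-! ### The density -/

/-- The modified Bessel function `I_ν(x) = ∑_m (x/2)^(2m+ν) / (m! Γ(ν+m+1))`, for `x ≥ 0`. -/
def besselI (ν x : ℝ) : ℝ :=
  ∑' m : ℕ, 1 / ((m.factorial : ℝ) * Real.Gamma (ν + m + 1)) * (x / 2) ^ (2 * (m : ℝ) + ν)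

/-- The factor `I_{max(h_{x,y}, h_{y,x})}(2 √ρ_x C_{x,y} √ρ_y)` of the edge `{x,y}`. -/
def besselFactor {X : Type*} (C : Sym2 X → ℝ) (h : X → X → ℕ) (ρ : X → ℝ) : Sym2 X → ℝ :=
  Sym2.lift ⟨fun x y =>
    besselI ((max (h x y) (h y x) : ℕ) : ℝ) (2 * (√(ρ x) * C s(x, y) * √(ρ y))), fun x y => by
      dsimp only
      rw [max_comm, Sym2.eq_swap, mul_right_comm (√(ρ x)), mul_right_comm (√(ρ y)),
        mul_comm (√(ρ x)) (√(ρ y))]⟩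

/-- `det(I - P) ∏_{{x,y} ∈ E} I_{h_{x,y}}(2 √ρ_x C_{x,y} √ρ_y) ∏_x λ_x e^{-λ_x ρ_x}`. -/
def flowDensity {X : Type*} [Fintype X] [DecidableEq X] (G : SimpleGraph X) [DecidableRel G.Adj]
    (C : Sym2 X → ℝ) (κ : X → ℝ) (h : X → X → ℕ) (ρ : X → ℝ) : ℝ :=
  (1 - transitionMatrix C κ).det * (∏ e ∈ G.edgeFinset, besselFactor C h ρ e) *
    ∏ x, dualityMeasure C κ x * Real.exp (-(dualityMeasure C κ x * ρ x))

end

end LoopEnsemble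

/-! The joint law of all jump counts and occupation times is identified through its Laplace
transform, and the flow statement follows from it by summation.

On the loop side, Campbell's theorem (`IsPoissonProcess.lintegral_expNeg`) turns the Laplace
transform of a linear functional F of the loops into exp(-∫(1 - e^{-F}) dμ). Writing the factor 1/t
of the loop measure as ∫₀^∞ e^{-rt} dr makes the sojourns of a discrete loop independent. The sum
over loops becomes a difference of traces of the resolvents of P and of a damped matrix N, shifted
by r. Neither trace is integrable alone at infinity, but by Jacobi's formula their difference is the
derivative in r of a logarithm of a ratio of determinants, and that ratio tends to 1. This gives
det(I - P) / det(D - N), with D = diag(1 + b/λ) and N = (P_{x,y} e^{-a_{x,y}}), where a and b are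
the costs of jumps and of occupation (`expNeg_lintegral_loopMeasure`).

The candidate joint law `jointLaw` puts on each balanced network k the density det(I - P) ∏ C^k/k! ∏
ρ_x^{k_x} λ_x e^{-λ_x ρ_x}. Its Laplace transform is a product of Gamma integrals summed over
balanced networks. The factorials k_x! that they produce are exactly those of MacMahon's master
theorem (`balancedSum_eq`), which returns the same ratio of determinants. Integer values of the
Laplace variables suffice, by Stone–Weierstrass on [0,∞]^K (`measure_ext_of_lintegral_expNeg`).
Since infinite values are allowed there, finiteness and the Eulerian property are conclusions, read
off from `jointLaw`.

Finally, the networks on the graph that induce a flow h are h plus m_e crossings of each edge e in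
both directions, with m arbitrary. As k is balanced, ∏ ρ_x^{k_x} is a product over oriented edges of
powers of √ρ_x √ρ_y. The sum over m therefore splits into one power series per edge, and each is a
Bessel function (`tsum_networkDensity_eq_flowDensity`).

All convergence and positivity questions about matrices rest on `Subcritical`, a condition inherited
by entrywise smaller nonnegative matrices and by Gaussian elimination. -/

namespace LoopEnsemble

open Filter Topology

/-! ### The function `t ↦ e^{-t}` on `[0, ∞]` -/

/-- The function `t ↦ e^{-t}` on `[0, ∞]`, with `e^{-∞} = 0`. -/
noncomputable def expNeg (t : ℝ≥0∞) : ℝ≥0∞ := (EReal.exp t)⁻¹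

theorem continuous_expNeg : Continuous expNeg :=
  continuous_inv.comp (ENNReal.continuous_exp.comp continuous_coe_ennreal_ereal)

theorem measurable_expNeg : Measurable expNeg := continuous_expNeg.measurable

theorem expNeg_antitone : Antitone expNeg := fun _ _ h =>
  ENNReal.inv_le_inv.2 (EReal.exp_monotone (EReal.coe_ennreal_le_coe_ennreal_iff.2 h))

theorem expNeg_injective : Function.Injective expNeg := fun _ _ h =>
  EReal.coe_ennreal_injective (EReal.exp_strictMono.injective (inv_injective h))

@[simp] theorem expNeg_zero : expNeg 0 = 1 := by simp [expNeg]

theorem expNeg_le_one (t : ℝ≥0∞) : expNeg t ≤ 1 := by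
  rw [← expNeg_zero]
  exact expNeg_antitone zero_le

theorem expNeg_ne_top (t : ℝ≥0∞) : expNeg t ≠ ∞ :=
  ((expNeg_le_one t).trans_lt ENNReal.one_lt_top).ne

theorem expNeg_ofReal {t : ℝ} (ht : 0 ≤ t) :
    expNeg (ENNReal.ofReal t) = ENNReal.ofReal (Real.exp (-t)) := by
  rw [expNeg, EReal.coe_ennreal_ofReal, max_eq_left ht, EReal.exp_coe, Real.exp_neg,
    ENNReal.ofReal_inv_of_pos (Real.exp_pos t)]

theorem expNeg_coe (t : ℝ≥0) : expNeg t = ENNReal.ofReal (Real.exp (-t)) := by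
  rw [← expNeg_ofReal t.coe_nonneg, ENNReal.ofReal_coe_nnreal]

theorem expNeg_add (s t : ℝ≥0∞) : expNeg (s + t) = expNeg s * expNeg t := by
  have h (u : ℝ≥0∞) : EReal.exp u ≠ 0 := by simp
  rw [expNeg, EReal.coe_ennreal_add, EReal.exp_add,
    ENNReal.mul_inv (Or.inl (h s)) (Or.inr (h t))]
  rfl

theorem expNeg_sum {ι : Type*} (s : Finset ι) (f : ι → ℝ≥0∞) :
    expNeg (∑ i ∈ s, f i) = ∏ i ∈ s, expNeg (f i) := by
  classical
  induction s using Finset.induction with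
  | empty => simp
  | insert a s ha ih => rw [Finset.sum_insert ha, Finset.prod_insert ha, expNeg_add, ih]

theorem expNeg_natCast_mul (n : ℕ) (t : ℝ≥0∞) : expNeg (n * t) = expNeg t ^ n := by
  rw [← nsmul_eq_mul, ← Finset.card_range n, ← Finset.sum_const, expNeg_sum, Finset.prod_const]

theorem expNeg_lt_one {t : ℝ≥0∞} (ht : t ≠ 0) : expNeg t < 1 :=
  lt_of_le_of_ne (expNeg_le_one t) fun h => ht (expNeg_injective (h.trans expNeg_zero.symm))

/-! ### The Laplace functional of a Poisson process -/

theorem lintegral_expNeg_mul_poissonMeasure (r c : ℝ≥0) :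
    ∫⁻ n : ℕ, expNeg (c * n) ∂poissonMeasure r = expNeg (r * (1 - expNeg c)) := by
  have h1 : Real.exp (-(c : ℝ)) ≤ 1 := Real.exp_le_one_iff.2 (by simp)
  have h2 : (r : ℝ≥0∞) * (1 - expNeg c) = ENNReal.ofReal (r * (1 - Real.exp (-c))) := by
    rw [expNeg_coe, ENNReal.ofReal_mul r.coe_nonneg, ENNReal.ofReal_coe_nnreal,
      ENNReal.ofReal_sub _ (Real.exp_pos _).le, ENNReal.ofReal_one]
  rw [h2, expNeg_ofReal (mul_nonneg r.coe_nonneg (sub_nonneg.2 h1)), lintegral_countable']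
  have h3 : HasSum (fun n : ℕ => Real.exp (-r) * (r * Real.exp (-c)) ^ n / n.factorial)
      (Real.exp (-(r * (1 - Real.exp (-c))))) := by
    have := (NormedSpace.expSeries_div_hasSum_exp (𝔸 := ℝ) ((r : ℝ) * Real.exp (-c))).mul_left
      (Real.exp (-r))
    rw [← Real.exp_eq_exp_ℝ, ← Real.exp_add] at this
    rw [show -((r : ℝ) * (1 - Real.exp (-c))) = -r + r * Real.exp (-c) by ring]
    simpa only [mul_div_assoc] using this
  rw [← h3.tsum_eq, ENNReal.ofReal_tsum_of_nonneg _ h3.summable]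
  · congr 1
    funext n
    rw [poissonMeasure_singleton, mul_comm (c : ℝ≥0∞), expNeg_natCast_mul, expNeg_coe,
      ← ENNReal.ofReal_pow (Real.exp_pos _).le, ← ENNReal.ofReal_mul (by positivity)]
    congr 1
    ring
  · intro n; positivity

section Poisson

variable {Ω E : Type*} [MeasurableSpace Ω] [MeasurableSpace E] {L : Ω → Measure E}
  {ν : Measure E} {Pr : Measure Ω}

theorem IsPoissonProcess.lintegral_expNeg_mul (hL : IsPoissonProcess L ν Pr) {A : Set E}
    (hA : MeasurableSet A) (hνA : ν A ≠ ∞) {c : ℝ≥0∞} (hc : c ≠ ∞) :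
    ∫⁻ ω, expNeg (c * L ω A) ∂Pr = expNeg ((1 - expNeg c) * ν A) := by
  lift c to ℝ≥0 using hc
  have h1 : Measurable fun t : ℝ≥0∞ => expNeg (c * t) :=
    measurable_expNeg.comp (measurable_const.mul measurable_id)
  have h2 := lintegral_map (μ := Pr) h1 ((Measure.measurable_coe hA).comp hL.measurable)
  simp only [Function.comp_apply] at h2
  rw [← h2, Function.comp_def, hL.law A hA hνA, lintegral_map h1 (measurable_of_countable _),
    lintegral_expNeg_mul_poissonMeasure, ENNReal.coe_toNNReal hνA, mul_comm]

/-- The counts on the disjoint level sets of `f` are independent, so the expectation factorises over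
its values. The level set of 0 may have infinite intensity, which is why finiteness is only required
for `c ≠ 0`. -/
theorem IsPoissonProcess.lintegral_expNeg_simpleFunc [IsProbabilityMeasure Pr]
    (hL : IsPoissonProcess L ν Pr)
    (f : SimpleFunc E ℝ≥0∞) (hf : ∀ c ∈ f.range, c ≠ ∞)
    (hν : ∀ c ∈ f.range, c ≠ 0 → ν (f ⁻¹' {c}) ≠ ∞) :
    ∫⁻ ω, expNeg (∫⁻ l, f l ∂L ω) ∂Pr = expNeg (∫⁻ l, (1 - expNeg (f l)) ∂ν) := by
  have hg : ∫⁻ l, (1 - expNeg (f l)) ∂ν = ∑ c ∈ f.range, (1 - expNeg c) * ν (f ⁻¹' {c}) := by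
    have := SimpleFunc.map_lintegral (fun c : ℝ≥0∞ => 1 - expNeg c) f (μ := ν)
    rw [← this, ← SimpleFunc.lintegral_eq_lintegral]
    rfl
  rw [hg, expNeg_sum]
  have hf' (ω : Ω) : expNeg (∫⁻ l, f l ∂L ω) = ∏ c ∈ f.range, expNeg (c * L ω (f ⁻¹' {c})) := by
    rw [← expNeg_sum, ← SimpleFunc.lintegral, SimpleFunc.lintegral_eq_lintegral]
  simp only [hf']
  let e := f.range.equivFin.symm
  have hprod (F : ℝ≥0∞ → ℝ≥0∞) : ∏ c ∈ f.range, F c = ∏ i, F (e i) := by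
    rw [← Finset.prod_coe_sort, ← e.prod_comp]
  simp only [hprod]
  have hind := hL.indep _ (fun i => f ⁻¹' {(e i : ℝ≥0∞)}) (fun i => f.measurableSet_preimage _)
    (fun i j hij => Disjoint.preimage _ (by
      rw [Set.disjoint_singleton]
      exact fun h => hij (e.injective (Subtype.ext h))))
  have hcm (i) : Measurable fun t : ℝ≥0∞ => expNeg ((e i : ℝ≥0∞) * t) :=
    measurable_expNeg.comp (measurable_const.mul measurable_id)
  have hind2 := hind.comp (fun i t => expNeg ((e i : ℝ≥0∞) * t)) hcm
  have hfac := lintegral_prod_eq_prod_lintegral_of_indepFun Finset.univ _ hind2 (fun i =>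
    (hcm i).comp ((Measure.measurable_coe (f.measurableSet_preimage _)).comp hL.measurable))
  simp only [Function.comp_apply] at hfac
  rw [hfac]
  refine Finset.prod_congr rfl fun i _ => ?_
  -- For the value 0 both factors are 1, whatever the measure of the level set.
  by_cases h0 : (e i : ℝ≥0∞) = 0
  · simp [h0]
  · exact hL.lintegral_expNeg_mul (f.measurableSet_preimage _) (hν _ (e i).2 h0) (hf _ (e i).2)

/-- **Campbell's theorem**: the Laplace functional of a Poisson process. -/
theorem IsPoissonProcess.lintegral_expNeg [IsProbabilityMeasure Pr]
    (hL : IsPoissonProcess L ν Pr) {f : E → ℝ≥0∞} (hf : Measurable f)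
    (hν : ∫⁻ l, (1 - expNeg (f l)) ∂ν ≠ ∞) :
    ∫⁻ ω, expNeg (∫⁻ l, f l ∂L ω) ∂Pr = expNeg (∫⁻ l, (1 - expNeg (f l)) ∂ν) := by
  let g := SimpleFunc.eapprox f
  have hgm : Monotone g := SimpleFunc.monotone_eapprox f
  have hlim (μ : Measure E) (φ : ℝ≥0∞ → ℝ≥0∞) (hφ : Continuous φ) (hm : Monotone φ) :
      Tendsto (fun n => ∫⁻ l, φ (g n l) ∂μ) atTop (𝓝 (∫⁻ l, φ (f l) ∂μ)) := by
    refine lintegral_tendsto_of_tendsto_of_monotone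
      (fun n => (hφ.measurable.comp (g n).measurable).aemeasurable)
      (.of_forall fun l i j hij => hm (hgm hij l)) (.of_forall fun l => ?_)
    exact (hφ.tendsto _).comp (SimpleFunc.tendsto_eapprox hf l)
  have hmono : Monotone fun c : ℝ≥0∞ => 1 - expNeg c := fun a b h =>
    tsub_le_tsub_left (expNeg_antitone h) 1
  have hcont : Continuous fun c : ℝ≥0∞ => 1 - expNeg c :=
    (ENNReal.continuous_sub_left ENNReal.one_ne_top).comp continuous_expNeg
  have hmeas (h : E → ℝ≥0∞) (hh : Measurable h) : Measurable fun ω => ∫⁻ l, h l ∂L ω :=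
    (Measure.measurable_lintegral hh).comp hL.measurable
  have h1 : Tendsto (fun n => ∫⁻ ω, expNeg (∫⁻ l, g n l ∂L ω) ∂Pr) atTop
      (𝓝 (∫⁻ ω, expNeg (∫⁻ l, f l ∂L ω) ∂Pr)) := by
    -- The integrands decrease, so monotone convergence is replaced by domination by 1 on a
    -- probability space.
    refine tendsto_lintegral_of_dominated_convergence (fun _ => 1)
      (fun n => measurable_expNeg.comp (hmeas _ (g n).measurable))
      (fun n => .of_forall fun ω => expNeg_le_one _) (by simp) (.of_forall fun ω => ?_)
    exact (continuous_expNeg.tendsto _).comp (hlim (L ω) id continuous_id monotone_id)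
  have h2 : Tendsto (fun n => expNeg (∫⁻ l, (1 - expNeg (g n l)) ∂ν)) atTop
      (𝓝 (expNeg (∫⁻ l, (1 - expNeg (f l)) ∂ν))) :=
    (continuous_expNeg.tendsto _).comp (hlim ν _ hcont hmono)
  refine tendsto_nhds_unique h1 (h2.congr fun n => ?_)
  refine (hL.lintegral_expNeg_simpleFunc (g n) ?_ ?_).symm
  · intro c hc
    obtain ⟨l, rfl⟩ := SimpleFunc.mem_range.1 hc
    exact (SimpleFunc.eapprox_lt_top f n l).ne
  · intro c _ hc0 htop
    -- Markov's inequality: (1 - e^{-c}) ν(g_n = c) is at most the finite integral of 1 - e^{-f},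
    -- because g_n ≤ f.
    have hpos : 1 - expNeg c ≠ 0 := (tsub_pos_of_lt (expNeg_lt_one hc0)).ne'
    apply hν
    rw [eq_top_iff, ← ENNReal.mul_top hpos, ← htop,
      ← setLIntegral_const]
    refine (setLIntegral_mono' ((g n).measurableSet_preimage _) fun l hl => ?_).trans
      (setLIntegral_le_lintegral _ _)
    have : g n l = c := hl
    rw [← this]
    exact hmono ((SimpleFunc.iSup_eapprox_apply hf l).symm ▸
      le_iSup (fun n => SimpleFunc.eapprox f n l) n)

end Poisson


/-! ### Subcritical nonnegative matrices -/

section Matrix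

open Matrix

variable {ι : Type*} [Fintype ι]

/-- A nonnegative matrix is subcritical if it strictly decreases some positive vector. -/
structure Subcritical (M : Matrix ι ι ℝ) : Prop where
  nonneg : ∀ i j, 0 ≤ M i j
  exists_mulVec_lt : ∃ g : ι → ℝ, (∀ i, 0 < g i) ∧ ∀ i, (M *ᵥ g) i < g i

theorem Subcritical.mono {M M' : Matrix ι ι ℝ} (h : Subcritical M) (h0 : ∀ i j, 0 ≤ M' i j)
    (hle : ∀ i j, M' i j ≤ M i j) : Subcritical M' := by
  obtain ⟨g, hg, hlt⟩ := h.exists_mulVec_lt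
  refine ⟨h0, g, hg, fun i => lt_of_le_of_lt ?_ (hlt i)⟩
  exact Finset.sum_le_sum fun j _ => mul_le_mul_of_nonneg_right (hle i j) (hg j).le

variable [DecidableEq ι]

theorem Subcritical.pow_nonneg {M : Matrix ι ι ℝ} (h : Subcritical M) (n : ℕ) (i j : ι) :
    0 ≤ (M ^ n) i j := by
  induction n generalizing i j with
  | zero => rw [pow_zero, one_apply]; split_ifs <;> simp
  | succ n ih =>
    rw [pow_succ, mul_apply]
    exact Finset.sum_nonneg fun k _ => mul_nonneg (ih i k) (h.nonneg k j)

/-- Telescoping: ∑_{n<N} M^n (g - Mg) = g - M^N g ≤ g. Since g - Mg has positive entries, this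
bounds the partial sums of each entry of M^n. -/
theorem Subcritical.summable_pow_apply {M : Matrix ι ι ℝ} (h : Subcritical M) (i j : ι) :
    Summable fun n => (M ^ n) i j := by
  obtain ⟨g, hg, hlt⟩ := h.exists_mulVec_lt
  have key (N : ℕ) : ∑ n ∈ Finset.range N, (M ^ n *ᵥ (g - M *ᵥ g)) i = g i - (M ^ N *ᵥ g) i := by
    induction N with
    | zero => simp
    | succ N ih =>
      rw [Finset.sum_range_succ, ih, mulVec_sub, mulVec_mulVec, ← pow_succ]
      simp
  have hδ : 0 < (g - M *ᵥ g) j := sub_pos.2 (hlt j)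
  refine (summable_mul_right_iff hδ.ne').1 (summable_of_sum_range_le (c := g i)
    (fun n => mul_nonneg (h.pow_nonneg n i j) hδ.le) fun N => ?_)
  calc ∑ n ∈ Finset.range N, (M ^ n) i j * (g - M *ᵥ g) j
      ≤ ∑ n ∈ Finset.range N, (M ^ n *ᵥ (g - M *ᵥ g)) i :=
        Finset.sum_le_sum fun n _ => Finset.single_le_sum
          (f := fun k => (M ^ n) i k * (g - M *ᵥ g) k)
          (fun k _ => mul_nonneg (h.pow_nonneg n i k) (sub_pos.2 (hlt k)).le) (Finset.mem_univ j)
    _ = g i - (M ^ N *ᵥ g) i := key N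
    _ ≤ g i := sub_le_self _ (Finset.sum_nonneg fun k _ =>
        mul_nonneg (h.pow_nonneg N i k) (hg k).le)

theorem Subcritical.summable_pow {M : Matrix ι ι ℝ} (h : Subcritical M) :
    Summable (M ^ ·) :=
  Pi.summable.2 fun i => Pi.summable.2 fun j => h.summable_pow_apply i j

theorem Subcritical.isUnit_det {M : Matrix ι ι ℝ} (h : Subcritical M) : IsUnit (1 - M).det :=
  isUnit_det_of_left_inverse h.summable_pow.tsum_pow_mul_one_sub

theorem Subcritical.hasSum_pow_apply {M : Matrix ι ι ℝ} (h : Subcritical M) (i j : ι) :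
    HasSum (fun n => (M ^ n) i j) ((1 - M)⁻¹ i j) := by
  rw [inv_eq_left_inv h.summable_pow.tsum_pow_mul_one_sub]
  exact Pi.hasSum.1 (Pi.hasSum.1 h.summable_pow.hasSum i) j

/-- Along t ∈ [0,1] the matrix tM stays subcritical, so det(1 - tM) never vanishes. It equals 1 at t
= 0, hence is positive at t = 1. -/
theorem Subcritical.det_pos {M : Matrix ι ι ℝ} (h : Subcritical M) : 0 < (1 - M).det := by
  by_contra hneg
  have hc : ContinuousOn (fun t : ℝ => (1 - t • M).det) (Set.Icc 0 1) :=
    (Continuous.matrix_det (by fun_prop)).continuousOn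
  have := intermediate_value_Icc' (zero_le_one' ℝ) hc
  obtain ⟨t, ht, h0⟩ := this ⟨by simpa using not_lt.1 hneg, by simp⟩
  have hsub : Subcritical (t • M) := h.mono (fun i j => mul_nonneg ht.1 (h.nonneg i j))
    fun i j => mul_le_of_le_one_left (h.nonneg i j) ht.2
  exact hsub.isUnit_det.ne_zero h0

/-! ### Resolvents and determinants of a diagonal minus a nonnegative matrix -/

section Resolvent

variable {D : ι → ℝ} {N : Matrix ι ι ℝ}

theorem diagonal_sub_eq_mul (hD : ∀ i, D i ≠ 0) :
    diagonal D - N = diagonal D * (1 - of fun i j => N i j / D i) := by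
  ext i j
  rw [mul_sub, mul_one, Matrix.sub_apply, Matrix.sub_apply, diagonal_mul, of_apply, mul_div_cancel₀ _ (hD i)]

theorem det_diagonal_sub (hD : ∀ i, D i ≠ 0) :
    (diagonal D - N).det = (∏ i, D i) * (1 - of fun i j => N i j / D i).det := by
  rw [diagonal_sub_eq_mul hD, det_mul, det_diagonal]

theorem det_diagonal_sub_pos (hD : ∀ i, 0 < D i)
    (h : Subcritical (of fun i j => N i j / D i)) : 0 < (diagonal D - N).det := by
  rw [det_diagonal_sub fun i => (hD i).ne']
  exact mul_pos (Finset.prod_pos fun i _ => hD i) h.det_pos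

theorem hasSum_trace_inv_diagonal_sub (hD : ∀ i, 0 < D i)
    (h : Subcritical (of fun i j => N i j / D i)) :
    HasSum (fun n => ∑ i, ((of fun i j => N i j / D i) ^ n : Matrix ι ι ℝ) i i / D i)
      (diagonal D - N)⁻¹.trace := by
  rw [diagonal_sub_eq_mul fun i => (hD i).ne', Matrix.mul_inv_rev, trace]
  refine hasSum_sum fun i _ => ?_
  have : (diagonal D)⁻¹ = diagonal fun i => (D i)⁻¹ := by
    refine inv_eq_left_inv ?_
    rw [diagonal_mul_diagonal, ← diagonal_one]
    congr 1
    funext i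
    exact inv_mul_cancel₀ (hD i).ne'
  rw [this, diag_apply, mul_diagonal, ← div_eq_mul_inv]
  exact (h.hasSum_pow_apply i i).div_const _

end Resolvent

/-- Jacobi's formula. With B = r + A factored out, det(s + A) = det B · det(1 + (s - r)B⁻¹), and the
last determinant is a polynomial in s - r with constant term 1 and linear coefficient tr B⁻¹. -/
theorem hasDerivAt_det_smul_one_add (A : Matrix ι ι ℝ) (r : ℝ)
    (h : (r • (1 : Matrix ι ι ℝ) + A).det ≠ 0) :
    HasDerivAt (fun r : ℝ => (r • (1 : Matrix ι ι ℝ) + A).det)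
      ((r • (1 : Matrix ι ι ℝ) + A).det * (r • (1 : Matrix ι ι ℝ) + A)⁻¹.trace) r := by
  set B := r • (1 : Matrix ι ι ℝ) + A with hB
  have hfun : (fun r : ℝ => (r • (1 : Matrix ι ι ℝ) + A).det) = fun s : ℝ =>
      B.det * (1 + B⁻¹.trace * (s - r) +
        (det (1 + (Polynomial.X : Polynomial ℝ) • B⁻¹.map Polynomial.C)).divX.divX.eval (s - r) *
          (s - r) ^ 2) := by
    funext s
    rw [← det_one_add_smul, ← det_mul, mul_add, mul_one, mul_smul_comm,
      mul_nonsing_inv _ (isUnit_iff_ne_zero.2 h), hB]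
    congr 1
    module
  rw [hfun]
  set p := (det (1 + (Polynomial.X : Polynomial ℝ) • B⁻¹.map Polynomial.C)).divX.divX
  have h1 : HasDerivAt (fun s : ℝ => s - r) 1 r := (hasDerivAt_id r).sub_const r
  have h2 : HasDerivAt (fun s : ℝ => p.eval (s - r)) (p.derivative.eval (r - r) * 1) r :=
    HasDerivAt.comp (h₂ := fun x => p.eval x) r (p.hasDerivAt (r - r)) h1
  convert! ((((h1.const_mul B⁻¹.trace).const_add 1).add (h2.mul (h1.pow 2)))).const_mul B.det using 1
  simp

/-- Both determinants are characteristic polynomials in r, monic of the same degree. -/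
theorem tendsto_det_smul_one_add_div (A B : Matrix ι ι ℝ) :
    Tendsto (fun r : ℝ => (r • (1 : Matrix ι ι ℝ) + A).det / (r • (1 : Matrix ι ι ℝ) + B).det)
      atTop (𝓝 1) := by
  have h (A : Matrix ι ι ℝ) (r : ℝ) :
      (r • (1 : Matrix ι ι ℝ) + A).det = (-A).charpoly.eval r := by
    rw [eval_charpoly, sub_neg_eq_add, scalar_apply, smul_one_eq_diagonal]
  simp only [h]
  have := Polynomial.div_tendsto_atTop_leadingCoeff_div_of_degree_eq (-A).charpoly (-B).charpoly
    (by rw [charpoly_degree_eq_dim, charpoly_degree_eq_dim])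
  rwa [(charpoly_monic _).leadingCoeff, (charpoly_monic _).leadingCoeff, div_one] at this

/-- The integral over `r` of the difference of two resolvent traces. -/
theorem expNeg_lintegral_trace_inv_sub (A B : Matrix ι ι ℝ)
    (hA : ∀ r : ℝ, 0 ≤ r → 0 < (r • (1 : Matrix ι ι ℝ) + A).det)
    (hB : ∀ r : ℝ, 0 ≤ r → 0 < (r • (1 : Matrix ι ι ℝ) + B).det)
    (hle : ∀ r : ℝ, 0 ≤ r →
      (r • (1 : Matrix ι ι ℝ) + B)⁻¹.trace ≤ (r • (1 : Matrix ι ι ℝ) + A)⁻¹.trace) :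
    ∫⁻ r : ℝ in Set.Ioi 0, ENNReal.ofReal
      ((r • (1 : Matrix ι ι ℝ) + A)⁻¹.trace - (r • (1 : Matrix ι ι ℝ) + B)⁻¹.trace) ≠ ∞ ∧
    expNeg (∫⁻ r : ℝ in Set.Ioi 0, ENNReal.ofReal
      ((r • (1 : Matrix ι ι ℝ) + A)⁻¹.trace - (r • (1 : Matrix ι ι ℝ) + B)⁻¹.trace)) =
      ENNReal.ofReal (A.det / B.det) := by
  -- An antiderivative of the difference of traces, equal to 0 at infinity. The integral is
  -- therefore -Φ(0), and e^{Φ(0)} is the ratio of determinants.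
  let Φ : ℝ → ℝ := fun r =>
    Real.log ((r • (1 : Matrix ι ι ℝ) + A).det) - Real.log ((r • (1 : Matrix ι ι ℝ) + B).det)
  have hder : ∀ r ∈ Set.Ici (0 : ℝ), HasDerivAt Φ
      ((r • (1 : Matrix ι ι ℝ) + A)⁻¹.trace - (r • (1 : Matrix ι ι ℝ) + B)⁻¹.trace) r := by
    intro r hr
    have h1 := (hasDerivAt_det_smul_one_add A r (hA r hr).ne').log (hA r hr).ne'
    have h2 := (hasDerivAt_det_smul_one_add B r (hB r hr).ne').log (hB r hr).ne'
    rw [mul_div_cancel_left₀ _ (hA r hr).ne'] at h1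
    rw [mul_div_cancel_left₀ _ (hB r hr).ne'] at h2
    exact h1.sub h2
  have hnn : ∀ r ∈ Set.Ioi (0 : ℝ), 0 ≤
      (r • (1 : Matrix ι ι ℝ) + A)⁻¹.trace - (r • (1 : Matrix ι ι ℝ) + B)⁻¹.trace :=
    fun r hr => sub_nonneg.2 (hle r (le_of_lt hr))
  have hlim : Tendsto Φ atTop (𝓝 0) := by
    have := ((Real.continuousAt_log one_ne_zero).tendsto.comp
      (tendsto_det_smul_one_add_div A B))
    rw [Real.log_one] at this
    refine this.congr' ?_
    filter_upwards [eventually_ge_atTop 0] with r hr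
    exact Real.log_div (hA r hr).ne' (hB r hr).ne'
  have hint := integral_Ioi_of_hasDerivAt_of_nonneg' hder hnn hlim
  have hintble := integrableOn_Ioi_deriv_of_nonneg' hder hnn hlim
  have hae : 0 ≤ᵐ[volume.restrict (Set.Ioi (0 : ℝ))] fun r : ℝ =>
      (r • (1 : Matrix ι ι ℝ) + A)⁻¹.trace - (r • (1 : Matrix ι ι ℝ) + B)⁻¹.trace :=
    (ae_restrict_iff' measurableSet_Ioi).2 (.of_forall hnn)
  rw [← ofReal_integral_eq_lintegral_ofReal hintble hae]
  refine ⟨ENNReal.ofReal_ne_top, ?_⟩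
  rw [expNeg_ofReal (integral_nonneg_of_ae hae), hint]
  congr 1
  have hA0 : 0 < A.det := by simpa using hA 0 le_rfl
  have hB0 : 0 < B.det := by simpa using hB 0 le_rfl
  simp only [Φ, zero_smul, zero_add]
  rw [zero_sub, neg_neg, Real.exp_sub, Real.exp_log hA0, Real.exp_log hB0]

end Matrix


/-! ### The transition matrix of a positive definite energy is subcritical -/

section Energy

open Matrix

variable {X : Type*} [Fintype X] {C : Sym2 X → ℝ} {κ : X → ℝ}

variable [DecidableEq X]

theorem diagonal_dualityMeasure_sub_mulVec (f : X → ℝ) (x : X) :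
    ((diagonal (dualityMeasure C κ) - of fun x y => C s(x, y)) *ᵥ f) x =
      dualityMeasure C κ x * f x - ∑ y, C s(x, y) * f y := by
  rw [sub_mulVec, Pi.sub_apply, mulVec_diagonal]
  rfl

theorem energy_eq_dotProduct (f : X → ℝ) : energy C κ f =
    f ⬝ᵥ ((diagonal (dualityMeasure C κ) - of fun x y => C s(x, y)) *ᵥ f) := by
  have h1 : ∑ x, ∑ y, C s(x, y) * (f x - f y) ^ 2 = ∑ x, ∑ y, C s(x, y) * f x ^ 2 +
      ∑ x, ∑ y, C s(x, y) * f y ^ 2 - 2 * ∑ x, ∑ y, C s(x, y) * f x * f y := by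
    simp only [Finset.mul_sum, ← Finset.sum_add_distrib, ← Finset.sum_sub_distrib]
    refine Finset.sum_congr rfl fun x _ => Finset.sum_congr rfl fun y _ => ?_
    ring
  have h2 : ∑ x, ∑ y, C s(x, y) * f y ^ 2 = ∑ x, ∑ y, C s(x, y) * f x ^ 2 := by
    rw [Finset.sum_comm]
    simp only [Sym2.eq_swap]
  rw [energy, h1, h2]
  simp only [dotProduct, diagonal_dualityMeasure_sub_mulVec, dualityMeasure]
  rw [show ∀ a b c : ℝ, 1 / 2 * (a + a - 2 * b) + c = a + c - b by intros; ring,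
    ← Finset.sum_add_distrib, ← Finset.sum_sub_distrib]
  refine Finset.sum_congr rfl fun x _ => ?_
  rw [← Finset.sum_mul, mul_sub, Finset.mul_sum, add_mul, mul_add]
  congr 1
  · ring
  · exact Finset.sum_congr rfl fun y _ => by ring

/-- The energy of the indicator of `x` is `λ_x - C s(x, x)`, so positive definiteness gives the
bound. -/
theorem dualityMeasure_pos (hC : ∀ e, 0 ≤ C e) (hE : ∀ f : X → ℝ, f ≠ 0 → 0 < energy C κ f)
    (x : X) : 0 < dualityMeasure C κ x := by
  have h := hE (Pi.single x 1) (by simp)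
  rw [energy_eq_dotProduct, single_one_dotProduct, diagonal_dualityMeasure_sub_mulVec] at h
  simp only [Pi.single_eq_same, mul_one] at h
  have h1 : (0 : X → ℝ) ≤ Pi.single x 1 := Pi.single_nonneg.2 zero_le_one
  have : 0 ≤ ∑ y, C s(x, y) * (Pi.single x (1 : ℝ) : X → ℝ) y :=
    Finset.sum_nonneg fun y _ => mul_nonneg (hC _) (h1 y)
  linarith

/-- The vector strictly decreased by P is the solution g of (λ - C)g = 1. It exists because the
energy form is definite and is nonnegative by a minimum principle. Then λg - Cg = 1 > 0 says Pg < g.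
-/
theorem subcritical_transitionMatrix (hC : ∀ e, 0 ≤ C e)
    (hE : ∀ f : X → ℝ, f ≠ 0 → 0 < energy C κ f) : Subcritical (transitionMatrix C κ) := by
  have hpos := dualityMeasure_pos hC hE
  refine ⟨fun x y => div_nonneg (hC _) (hpos x).le, ?_⟩
  set K : Matrix X X ℝ := diagonal (dualityMeasure C κ) - of fun x y => C s(x, y) with hK
  have hinj : Function.Injective K.mulVec := by
    refine (injective_iff_map_eq_zero K.mulVecLin).2 fun f hf => ?_
    by_contra hne
    have := hE f hne
    rw [energy_eq_dotProduct, ← hK, show K *ᵥ f = 0 from hf, dotProduct_zero] at this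
    exact this.ne rfl
  have hunit := mulVec_injective_iff_isUnit.1 hinj
  obtain ⟨g, hg⟩ : ∃ g, K *ᵥ g = 1 := ⟨K⁻¹ *ᵥ 1, by
    rw [mulVec_mulVec, mul_nonsing_inv _ ((isUnit_iff_isUnit_det K).1 hunit), one_mulVec]⟩
  have hgx (x : X) : dualityMeasure C κ x * g x - ∑ y, C s(x, y) * g y = 1 := by
    rw [← diagonal_dualityMeasure_sub_mulVec, ← hK, hg, Pi.one_apply]
  have hnn : 0 ≤ g := by
    -- Minimum principle, tested with the negative part m of g. As m(m + g) = 0 pointwise and m + g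
    -- ≥ 0, the pairing of m with (λ - C)(m + g) is at most 0. It also equals the energy of m plus ∑
    -- m, which is positive if m ≠ 0.
    by_contra hneg
    let m : X → ℝ := fun x => max (-g x) 0
    have hm0 (x : X) : 0 ≤ m x := le_max_right _ _
    have hmg (x : X) : 0 ≤ m x + g x := by
      have : -g x ≤ m x := le_max_left _ _
      linarith
    have hmm (x : X) : m x * (m x + g x) = 0 := by
      rcases le_total (g x) 0 with h | h
      · simp [m, max_eq_left (neg_nonneg.2 h)]
      · simp [m, max_eq_right (neg_nonpos.2 h)]
    have hmne : m ≠ 0 := by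
      intro h
      refine hneg fun x => ?_
      have := hmg x
      rw [h] at this
      simpa using this
    have h1 := hE m hmne
    have h2 : m ⬝ᵥ (K *ᵥ (m + g)) ≤ 0 := by
      refine Finset.sum_nonpos fun x _ => ?_
      rw [hK, diagonal_dualityMeasure_sub_mulVec, mul_sub, mul_left_comm, Pi.add_apply, hmm,
        mul_zero, zero_sub, neg_nonpos]
      exact mul_nonneg (hm0 x) (Finset.sum_nonneg fun y _ => mul_nonneg (hC _) (hmg y))
    rw [mulVec_add, hg, dotProduct_add, hK, ← energy_eq_dotProduct, dotProduct_one] at h2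
    have h3 : 0 ≤ ∑ x, m x := Finset.sum_nonneg fun x _ => hm0 x
    linarith
  have hlt (x : X) : ∑ y, C s(x, y) * g y < dualityMeasure C κ x * g x := by
    linarith [hgx x]
  refine ⟨g, fun x => ?_, fun x => ?_⟩
  · refine pos_of_mul_pos_right (lt_of_le_of_lt ?_ (hlt x)) (hpos x).le
    exact Finset.sum_nonneg fun y _ => mul_nonneg (hC _) (hnn y)
  · simp only [mulVec, dotProduct, transitionMatrix, of_apply, div_mul_eq_mul_div,
      ← Finset.sum_div]
    rw [div_lt_iff₀ (hpos x), mul_comm]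
    exact hlt x

end Energy


/-! ### MacMahon's master theorem -/

section MacMahon

open Matrix

theorem tsum_choose_mul_pow (j : ℕ) {b : ℝ} (h0 : 0 ≤ b) (h1 : b < 1) :
    ∑' i : ℕ, ((i + j).choose j : ℝ≥0∞) * ENNReal.ofReal b ^ i =
      ENNReal.ofReal (1 - b)⁻¹ ^ (j + 1) := by
  have hb : ‖b‖ < 1 := by rwa [Real.norm_of_nonneg h0]
  have h := hasSum_choose_mul_geometric_of_norm_lt_one j hb
  rw [← ENNReal.ofReal_pow (inv_nonneg.2 (sub_nonneg.2 h1.le)), inv_pow, ← one_div, ← h.tsum_eq,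
    ENNReal.ofReal_tsum_of_nonneg (fun n => by positivity) h.summable]
  congr 1
  funext i
  rw [ENNReal.ofReal_mul (by positivity), ENNReal.ofReal_natCast, ENNReal.ofReal_pow h0]

theorem coeff_C_add_C_mul_X_pow {S : Type*} [CommSemiring S] (a b : S) (m i : ℕ) :
    ((Polynomial.C a + Polynomial.C b * Polynomial.X) ^ m).coeff i =
      a ^ (m - i) * b ^ i * (m.choose i : S) := by
  have h (k : ℕ) : ((Polynomial.C b * Polynomial.X) ^ k * Polynomial.C a ^ (m - k) *
      (m.choose k : Polynomial S)).coeff i =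
      if i = k then a ^ (m - k) * b ^ k * (m.choose k : S) else 0 := by
    rw [Polynomial.coeff_mul_natCast, ← Polynomial.C_pow, Polynomial.coeff_mul_C, mul_pow,
      ← Polynomial.C_pow, Polynomial.coeff_C_mul_X_pow]
    split_ifs <;> ring
  rw [add_comm, add_pow, Polynomial.finsetSum_coeff]
  simp only [h, Finset.sum_ite_eq, Finset.mem_range]
  split_ifs with him
  · rfl
  · rw [Nat.choose_eq_zero_of_lt (by omega), Nat.cast_zero, mul_zero]

/-- The identity `∑_m [x^m] (a + b x)^m g(x) = (1 - b)⁻¹ g(a / (1 - b))`, coefficientwise for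
polynomials whose coefficients are themselves polynomials. -/
theorem tsum_coeff_pow_mul {n : ℕ} (a : MvPolynomial (Fin n) ℝ≥0∞) {b : ℝ} (h0 : 0 ≤ b)
    (h1 : b < 1) (k : Fin n →₀ ℕ) (g : Polynomial (MvPolynomial (Fin n) ℝ≥0∞)) :
    ∑' m : ℕ, ((((Polynomial.C a + Polynomial.C (MvPolynomial.C (ENNReal.ofReal b)) *
        Polynomial.X) ^ m * g).coeff m).coeff k) =
      ENNReal.ofReal (1 - b)⁻¹ *
        (g.eval (MvPolynomial.C (ENNReal.ofReal (1 - b)⁻¹) * a)).coeff k := by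
  induction g using Polynomial.induction_on' with
  | add p q hp hq =>
    simp only [mul_add, Polynomial.coeff_add, MvPolynomial.coeff_add, Polynomial.eval_add]
    rw [ENNReal.summable.tsum_add ENNReal.summable, hp, hq]
  | monomial j c =>
    have hzero (m : ℕ) (hm : m < j) : ((Polynomial.C a + Polynomial.C (MvPolynomial.C
        (ENNReal.ofReal b)) * Polynomial.X) ^ m * Polynomial.monomial j c).coeff m = 0 := by
      rw [← Polynomial.C_mul_X_pow_eq_monomial, ← mul_assoc, Polynomial.coeff_mul_X_pow',
        if_neg (not_le.2 hm)]
    -- For m = i + j only the term in x^i of (a + bx)^m contributes. Summing over i then gives the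
    -- negative binomial series of (1 - b)^{-(j+1)}.
    have hadd (i : ℕ) : (((Polynomial.C a + Polynomial.C (MvPolynomial.C
        (ENNReal.ofReal b)) * Polynomial.X) ^ (i + j) * Polynomial.monomial j c).coeff
          (i + j)).coeff k =
        (((i + j).choose j : ℝ≥0∞) * ENNReal.ofReal b ^ i) * (a ^ j * c).coeff k := by
      rw [Polynomial.coeff_mul_monomial, coeff_C_add_C_mul_X_pow, Nat.add_sub_cancel_left,
        Nat.choose_symm_add, ← MvPolynomial.coeff_C_mul, MvPolynomial.C_mul, map_natCast,
        MvPolynomial.C_pow]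
      congr 1
      ring
    rw [← Summable.sum_add_tsum_nat_add' (k := j) ENNReal.summable, Finset.sum_eq_zero, zero_add]
    · simp only [hadd]
      rw [ENNReal.tsum_mul_right, tsum_choose_mul_pow j h0 h1, Polynomial.eval_monomial, mul_pow,
        ← MvPolynomial.C_pow, mul_left_comm c, MvPolynomial.coeff_C_mul, pow_succ', mul_assoc,
        mul_comm c]
    · intro m hm
      rw [hzero m (Finset.mem_range.1 hm), MvPolynomial.coeff_zero]

/-- The sum over all `m` of the coefficient of `x^m` in `∏_i (∑_j M_{i,j} x_j)^{m_i}`. -/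
noncomputable def diagonalCoeffSum {n : ℕ} (M : Matrix (Fin n) (Fin n) ℝ) : ℝ≥0∞ :=
  ∑' m : Fin n →₀ ℕ, (∏ i, (∑ j, MvPolynomial.C (ENNReal.ofReal (M i j)) * MvPolynomial.X j) ^ m i :
    MvPolynomial (Fin n) ℝ≥0∞).coeff m

/-- The Schur complement of the upper left entry of `1 - M`, subtracted from `1`. -/
noncomputable def eliminate {n : ℕ} (M : Matrix (Fin (n + 1)) (Fin (n + 1)) ℝ) :
    Matrix (Fin n) (Fin n) ℝ :=
  of fun i j => M i.succ j.succ + M i.succ 0 * ((1 - M 0 0)⁻¹ * M 0 j.succ)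

theorem Subcritical.apply_zero_zero_lt_one {n : ℕ} {M : Matrix (Fin (n + 1)) (Fin (n + 1)) ℝ}
    (h : Subcritical M) : M 0 0 < 1 := by
  obtain ⟨g, hg, hlt⟩ := h.exists_mulVec_lt
  have h0 := hlt 0
  rw [mulVec, dotProduct, Fin.sum_univ_succ] at h0
  have h1 : 0 ≤ ∑ i : Fin n, M 0 i.succ * g i.succ :=
    Finset.sum_nonneg fun i _ => mul_nonneg (h.nonneg _ _) (hg _).le
  nlinarith [hg 0]

/-- Row 0 of Mg < g, solved for g_0, gives (1 - M_{00})⁻¹ ∑ M_{0j} g_j ≤ g_0. Substituting this in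
the other rows shows that the restriction of g still works. -/
theorem Subcritical.eliminate {n : ℕ} {M : Matrix (Fin (n + 1)) (Fin (n + 1)) ℝ}
    (h : Subcritical M) : Subcritical (eliminate M) := by
  have hb := sub_pos.2 h.apply_zero_zero_lt_one
  obtain ⟨g, hg, hlt⟩ := h.exists_mulVec_lt
  refine ⟨fun i j => add_nonneg (h.nonneg _ _) (mul_nonneg (h.nonneg _ _)
    (mul_nonneg (inv_nonneg.2 hb.le) (h.nonneg _ _))), fun i => g i.succ, fun i => hg _,
    fun i => ?_⟩
  have h0 := hlt 0
  have hi := hlt i.succ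
  simp only [mulVec, dotProduct, Fin.sum_univ_succ] at h0 hi
  simp only [mulVec, dotProduct, LoopEnsemble.eliminate, of_apply, add_mul,
    Finset.sum_add_distrib, mul_assoc, ← Finset.mul_sum]
  refine lt_of_le_of_lt ?_ hi
  rw [add_comm]
  gcongr
  · exact h.nonneg _ _
  · rw [inv_mul_le_iff₀ hb]
    linarith

theorem det_one_sub_eq_eliminate {n : ℕ} {M : Matrix (Fin (n + 1)) (Fin (n + 1)) ℝ}
    (hb : M 0 0 ≠ 1) : (1 - M).det = (1 - M 0 0) * (1 - eliminate M).det := by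
  have hb' : 1 - M 0 0 ≠ 0 := sub_ne_zero.2 hb.symm
  let e : Unit ⊕ Fin n ≃ Fin (n + 1) :=
    ((finSuccEquiv n).trans ((Equiv.optionEquivSumPUnit _).trans (Equiv.sumComm _ _))).symm
  have e0 : e (Sum.inl ()) = 0 := by simp [e]
  have e1 (i : Fin n) : e (Sum.inr i) = i.succ := by simp [e]
  let A : Matrix Unit Unit ℝ := of fun _ _ => 1 - M 0 0
  let : Invertible A := ⟨of fun _ _ => (1 - M 0 0)⁻¹,
    by ext; simp [A, mul_apply, hb'], by ext; simp [A, mul_apply, hb']⟩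
  have hblock : (1 - M).submatrix e e = fromBlocks A (of fun _ j => -M 0 j.succ)
      (of fun i _ => -M i.succ 0) (1 - of fun i j : Fin n => M i.succ j.succ) := by
    ext (i | i) (j | j)
    · simp [A, e0]
    · simp [e0, e1, one_apply, (Fin.succ_ne_zero j).symm]
    · simp [e0, e1, one_apply]
    · simp [e1, one_apply]
  rw [← det_submatrix_equiv_self e, hblock, det_fromBlocks₁₁]
  congr 1
  · simp [A]
  · congr 1
    ext i j
    simp [mul_apply, LoopEnsemble.eliminate, A]
    ring

/-- The equivalence given by `Finsupp.cons`. -/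
noncomputable def finsuppConsEquiv (n : ℕ) : (Fin n →₀ ℕ) × ℕ ≃ (Fin (n + 1) →₀ ℕ) where
  toFun p := Finsupp.cons p.2 p.1
  invFun m := (m.tail, m 0)
  left_inv p := by simp
  right_inv m := Finsupp.cons_tail m

/-- Summing over the exponent of x_0 amounts, by `tsum_coeff_pow_mul`, to substituting in the other
linear forms the value of x_0 that solves x_0 = (Mx)_0. This is one step of Gaussian elimination,
and it matches the Schur factorisation of det(1 - M). -/
theorem diagonalCoeffSum_eq_eliminate {n : ℕ} {M : Matrix (Fin (n + 1)) (Fin (n + 1)) ℝ}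
    (h : Subcritical M) :
    diagonalCoeffSum M = ENNReal.ofReal (1 - M 0 0)⁻¹ * diagonalCoeffSum (eliminate M) := by
  have hb := h.apply_zero_zero_lt_one
  rw [diagonalCoeffSum, ← (finsuppConsEquiv n).tsum_eq, ENNReal.tsum_prod', diagonalCoeffSum,
    ← ENNReal.tsum_mul_left]
  congr 1
  funext k
  let Λ : Fin (n + 1) → MvPolynomial (Fin n) ℝ≥0∞ := fun i =>
    ∑ j : Fin n, MvPolynomial.C (ENNReal.ofReal (M i j.succ)) * MvPolynomial.X j
  let g : Polynomial (MvPolynomial (Fin n) ℝ≥0∞) := ∏ i : Fin n,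
    (Polynomial.C (Λ i.succ) + Polynomial.C (MvPolynomial.C (ENNReal.ofReal (M i.succ 0))) *
      Polynomial.X) ^ k i
  have key := tsum_coeff_pow_mul (Λ 0) (h.nonneg 0 0) hb k g
  refine Eq.trans (tsum_congr fun m => ?_) (key.trans ?_)
  · rw [show finsuppConsEquiv n (k, m) = Finsupp.cons m k from rfl,
      ← MvPolynomial.finSuccEquiv_coeff_coeff]
    congr 2
    have hC (c : ℝ≥0∞) : MvPolynomial.finSuccEquiv ℝ≥0∞ n (MvPolynomial.C c) =
        Polynomial.C (MvPolynomial.C c) := by simp [MvPolynomial.finSuccEquiv_apply]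
    have hlin (i : Fin (n + 1)) : MvPolynomial.finSuccEquiv ℝ≥0∞ n
        (∑ j, MvPolynomial.C (ENNReal.ofReal (M i j)) * MvPolynomial.X j) =
        Polynomial.C (Λ i) + Polynomial.C (MvPolynomial.C (ENNReal.ofReal (M i 0))) *
          Polynomial.X := by
      rw [Fin.sum_univ_succ, map_add, map_mul, hC, MvPolynomial.finSuccEquiv_X_zero, map_sum,
        add_comm]
      congr 1
      simp only [Λ, map_sum, map_mul, hC, MvPolynomial.finSuccEquiv_X_succ]
    simp only [map_mul, map_prod, map_pow, hlin, Fin.prod_univ_succ, Finsupp.cons_zero,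
      Finsupp.cons_succ, g]
  · congr 2
    simp only [g, Polynomial.eval_prod, Polynomial.eval_pow, Polynomial.eval_add,
      Polynomial.eval_C, Polynomial.eval_mul, Polynomial.eval_X]
    refine Finset.prod_congr rfl fun i _ => ?_
    congr 1
    have hq : 0 ≤ (1 - M 0 0)⁻¹ := inv_nonneg.2 (sub_pos.2 hb).le
    simp only [Λ, Finset.mul_sum, ← Finset.sum_add_distrib]
    refine Finset.sum_congr rfl fun j _ => ?_
    rw [LoopEnsemble.eliminate, of_apply, ENNReal.ofReal_add (h.nonneg _ _)
      (mul_nonneg (h.nonneg _ _) (mul_nonneg hq (h.nonneg _ _))), ENNReal.ofReal_mul (h.nonneg _ _),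
      ENNReal.ofReal_mul hq]
    simp only [map_add, map_mul]
    ring

theorem diagonalCoeffSum_eq {n : ℕ} {M : Matrix (Fin n) (Fin n) ℝ} (h : Subcritical M) :
    diagonalCoeffSum M = ENNReal.ofReal (1 - M).det⁻¹ := by
  induction n with
  | zero => simp [diagonalCoeffSum]
  | succ n ih =>
    have hb := h.apply_zero_zero_lt_one
    rw [diagonalCoeffSum_eq_eliminate h, ih h.eliminate, det_one_sub_eq_eliminate hb.ne, mul_inv,
      ENNReal.ofReal_mul (inv_nonneg.2 (sub_pos.2 hb).le)]

end MacMahon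


/-! ### From coefficients of products of linear forms to balanced networks -/

section MacMahon

open Matrix

/-- The weight `∏_x (k_x! ∏_y M_{x,y}^{k_{x,y}} / k_{x,y}!)` of a network, with `k_x = ∑_y k_{x,y}`. -/
noncomputable def networkWeight {ι : Type*} [Fintype ι] (M : Matrix ι ι ℝ) (k : ι → ι → ℕ) : ℝ :=
  ∏ x, (((∑ y, k x y).factorial : ℝ) * ∏ y, M x y ^ k x y / (k x y).factorial)

/-- The networks with as much going out of every vertex as coming in. -/
def balanced (ι : Type*) [Fintype ι] : Set (ι → ι → ℕ) := {k | ∀ x, ∑ y, k x y = ∑ y, k y x}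

/-- The sum of the weights of the balanced networks. -/
noncomputable def balancedSum {ι : Type*} [Fintype ι] (M : Matrix ι ι ℝ) : ℝ≥0∞ :=
  ∑' k : ι → ι → ℕ, (balanced ι).indicator (fun k => ENNReal.ofReal (networkWeight M k)) k

theorem networkWeight_eq_multinomial {ι : Type*} [Fintype ι] (M : Matrix ι ι ℝ) (k : ι → ι → ℕ) :
    networkWeight M k =
      ∏ x, ((Nat.multinomial Finset.univ (k x) : ℝ) * ∏ y, M x y ^ k x y) := by
  refine Finset.prod_congr rfl fun x _ => ?_
  rw [Finset.prod_div_distrib, ← Nat.multinomial_spec, Nat.cast_mul, Nat.cast_prod]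
  have : (∏ y, ((k x y).factorial : ℝ)) ≠ 0 :=
    Finset.prod_ne_zero_iff.2 fun y _ => by positivity
  field_simp

theorem ofReal_networkWeight {ι : Type*} [Fintype ι] {M : Matrix ι ι ℝ} (hM : ∀ i j, 0 ≤ M i j)
    (k : ι → ι → ℕ) : ENNReal.ofReal (networkWeight M k) =
      ∏ x, ((Nat.multinomial Finset.univ (k x) : ℝ≥0∞) *
        ∏ y, ENNReal.ofReal (M x y) ^ k x y) := by
  rw [networkWeight_eq_multinomial, ENNReal.ofReal_prod_of_nonneg]
  · refine Finset.prod_congr rfl fun x _ => ?_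
    rw [ENNReal.ofReal_mul (Nat.cast_nonneg _), ENNReal.ofReal_natCast,
      ENNReal.ofReal_prod_of_nonneg fun y _ => pow_nonneg (hM x y) _]
    congr 1
    exact Finset.prod_congr rfl fun y _ => ENNReal.ofReal_pow (hM x y) _
  · exact fun x _ => mul_nonneg (Nat.cast_nonneg _)
      (Finset.prod_nonneg fun y _ => pow_nonneg (hM x y) _)

/-- The multinomial theorem in each row i distributes the exponent m_i over the entries k_{i,j}.
Extracting the coefficient of x^m prescribes the column sums as well. -/
theorem coeff_prod_linear_pow {n : ℕ} {M : Matrix (Fin n) (Fin n) ℝ} (hM : ∀ i j, 0 ≤ M i j)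
    (m : Fin n →₀ ℕ) :
    (∏ i, (∑ j, MvPolynomial.C (ENNReal.ofReal (M i j)) * MvPolynomial.X j) ^ m i :
      MvPolynomial (Fin n) ℝ≥0∞).coeff m =
    ∑' k : Fin n → Fin n → ℕ, if (∀ i, ∑ j, k i j = m i) ∧ (∀ j, ∑ i, k i j = m j) then
      ENNReal.ofReal (networkWeight M k) else 0 := by
  have hterm (k : Fin n → Fin n → ℕ) :
      (∏ i, ((Nat.multinomial Finset.univ (k i) : MvPolynomial (Fin n) ℝ≥0∞) *
        ∏ j, (MvPolynomial.C (ENNReal.ofReal (M i j)) * MvPolynomial.X j) ^ k i j)).coeff m =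
      if ∀ j, ∑ i, k i j = m j then ENNReal.ofReal (networkWeight M k) else 0 := by
    have : (∏ i, ((Nat.multinomial Finset.univ (k i) : MvPolynomial (Fin n) ℝ≥0∞) *
        ∏ j, (MvPolynomial.C (ENNReal.ofReal (M i j)) * MvPolynomial.X j) ^ k i j)) =
        MvPolynomial.monomial (Finsupp.equivFunOnFinite.symm fun j => ∑ i, k i j)
          (ENNReal.ofReal (networkWeight M k)) := by
      rw [MvPolynomial.monomial_eq, Finsupp.prod_fintype _ _ fun i => pow_zero _,
        ofReal_networkWeight hM]
      simp only [mul_pow, Finset.prod_mul_distrib, map_mul, map_prod, map_natCast, map_pow,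
        Finsupp.coe_equivFunOnFinite_symm, mul_assoc, ← Finset.prod_pow_eq_pow_sum]
      congr 2
      exact Finset.prod_comm
    rw [this, MvPolynomial.coeff_monomial]
    refine if_congr ?_ rfl rfl
    rw [DFunLike.ext_iff]
    rfl
  simp only [Finset.sum_pow_eq_sum_piAntidiag, Finset.prod_univ_sum, MvPolynomial.coeff_sum, hterm]
  rw [tsum_eq_sum (s := Fintype.piFinset fun i => Finset.piAntidiag Finset.univ (m i))]
  · refine Finset.sum_congr rfl fun k hk => if_congr ?_ rfl rfl
    simp only [Fintype.mem_piFinset, Finset.mem_piAntidiag] at hk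
    exact (and_iff_right fun i => (hk i).1).symm
  · intro k hk
    rw [if_neg]
    rintro ⟨h1, -⟩
    refine hk (Fintype.mem_piFinset.2 fun i => Finset.mem_piAntidiag.2 ⟨h1 i, fun j _ => ?_⟩)
    exact Finset.mem_univ j

/-- A network k appears only for the exponent m given by its row sums, and the column condition then
says that k is balanced. -/
theorem diagonalCoeffSum_eq_balancedSum {n : ℕ} {M : Matrix (Fin n) (Fin n) ℝ}
    (hM : ∀ i j, 0 ≤ M i j) : diagonalCoeffSum M = balancedSum M := by
  simp only [diagonalCoeffSum, coeff_prod_linear_pow hM]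
  rw [ENNReal.tsum_comm, balancedSum]
  refine tsum_congr fun k => ?_
  rw [tsum_eq_single (Finsupp.equivFunOnFinite.symm fun i => ∑ j, k i j)]
  · simp only [Finsupp.coe_equivFunOnFinite_symm, implies_true, true_and]
    by_cases hk : k ∈ balanced (Fin n)
    · rw [Set.indicator_of_mem hk, if_pos fun x => (hk x).symm]
    · rw [Set.indicator_of_notMem hk, if_neg fun h => hk fun x => (h x).symm]
  · intro m hm
    rw [if_neg]
    rintro ⟨h1, -⟩
    refine hm (Finsupp.ext fun i => (h1 i).symm)

/-- **MacMahon's master theorem** for a subcritical matrix. -/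
theorem balancedSum_eq {ι : Type*} [Fintype ι] [DecidableEq ι] {M : Matrix ι ι ℝ}
    (h : Subcritical M) : balancedSum M = ENNReal.ofReal (1 - M).det⁻¹ := by
  let e : Fin (Fintype.card ι) ≃ ι := (Fintype.equivFin ι).symm
  have hsub : Subcritical (M.submatrix e e) := by
    obtain ⟨g, hg, hlt⟩ := h.exists_mulVec_lt
    refine ⟨fun i j => h.nonneg _ _, g ∘ e, fun i => hg _, fun i => ?_⟩
    refine lt_of_eq_of_lt ?_ (hlt (e i))
    exact e.sum_comp fun j => M (e i) j * g j
  have hdet : (1 - M.submatrix e e).det = (1 - M).det := by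
    rw [← det_submatrix_equiv_self e (1 - M)]
    congr 1
    ext i j
    simp [one_apply]
  rw [← hdet, ← diagonalCoeffSum_eq hsub, diagonalCoeffSum_eq_balancedSum hsub.nonneg,
    balancedSum, balancedSum]
  let E : (ι → ι → ℕ) ≃ (Fin (Fintype.card ι) → Fin (Fintype.card ι) → ℕ) :=
    (e.symm.arrowCongr (e.symm.arrowCongr (Equiv.refl ℕ)))
  rw [← E.tsum_eq]
  have hE (k : ι → ι → ℕ) (i j) : E k i j = k (e i) (e j) := rfl
  refine tsum_congr fun k => ?_
  have hbal : E k ∈ balanced (Fin (Fintype.card ι)) ↔ k ∈ balanced ι := by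
    refine Iff.trans (forall_congr' fun i => ?_) (e.surjective.forall (p := fun x =>
      ∑ y, k x y = ∑ y, k y x)).symm
    simp only [hE]
    rw [e.sum_comp fun y => k (e i) y, e.sum_comp fun y => k y (e i)]
  have hw : networkWeight (M.submatrix e e) (E k) = networkWeight M k := by
    simp only [networkWeight, hE, submatrix_apply]
    rw [← e.prod_comp]
    refine Finset.prod_congr rfl fun i _ => ?_
    rw [e.sum_comp fun y => k (e i) y,
      e.prod_comp fun y => M (e i) y ^ k (e i) y / ((k (e i) y).factorial : ℝ)]
  by_cases hk : k ∈ balanced ι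
  · rw [Set.indicator_of_mem hk, Set.indicator_of_mem (hbal.2 hk), hw]
  · rw [Set.indicator_of_notMem hk, Set.indicator_of_notMem fun h => hk (hbal.1 h)]

end MacMahon


/-! ### Sums over discrete loops -/

section DiscreteLoop

open Matrix

theorem sum_paths {X : Type*} [Fintype X] [DecidableEq X] (M : Matrix X X ℝ) (f : X → ℝ) (n : ℕ)
    (x : X) : ∑ p : Fin (n + 1) → X, (if p 0 = x then
      (∏ i : Fin n, M (p i.castSucc) (p i.succ)) * f (p (Fin.last n)) else 0) =
      (M ^ n *ᵥ f) x := by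
  induction n generalizing x with
  | zero =>
    rw [← (Equiv.funUnique (Fin 1) X).symm.sum_comp]
    simp
  | succ n ih =>
    rw [← (Fin.consEquiv fun _ : Fin (n + 2) => X).sum_comp, Fintype.sum_prod_type,
      Finset.sum_eq_single x]
    · rw [pow_succ', ← mulVec_mulVec, mulVec, dotProduct]
      simp only [← ih, Finset.mul_sum]
      rw [Finset.sum_comm]
      refine Finset.sum_congr rfl fun p _ => ?_
      rw [Finset.sum_eq_single (p 0)]
      · simp only [Fin.consEquiv_apply, Fin.cons_zero, if_true, Fin.prod_univ_succ,
          Fin.castSucc_zero, Fin.cons_succ, Fin.castSucc_succ, ← Fin.succ_last, mul_assoc]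
      · intro y _ hy
        rw [if_neg hy.symm, mul_zero]
      · exact fun h => absurd (Finset.mem_univ _) h
    · intro y _ hy
      exact Finset.sum_eq_zero fun p _ => if_neg hy
    · exact fun h => absurd (Finset.mem_univ _) h

variable {X : Type*} {G : SimpleGraph X}

/-- A discrete loop is a closed path of length `n` for some `n`. -/
def discreteLoopEquiv (G : SimpleGraph X) : DiscreteLoop G ≃ Σ n : ℕ, {p : Fin (n + 1) → X //
    (∀ i : Fin n, G.Adj (p i.castSucc) (p i.succ)) ∧ p 0 = p (Fin.last n)} where
  toFun d := ⟨d.n, d.pt, d.adj, d.closed⟩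
  invFun q := ⟨q.1, q.2.1, q.2.2.1, q.2.2.2⟩
  left_inv _ := rfl
  right_inv _ := rfl

instance [Finite X] : Countable (DiscreteLoop G) :=
  (discreteLoopEquiv G).injective.countable

/-- The weight of a discrete loop, as a product over its jumps and its sojourns. -/
noncomputable def DiscreteLoop.weight (N : Matrix X X ℝ) (D : X → ℝ) (d : DiscreteLoop G) : ℝ :=
  (∏ i : Fin d.n, N (d.pt i.castSucc) (d.pt i.succ)) * ∏ i, (D (d.pt i))⁻¹

/-- A loop with n jumps has n + 1 sojourns: n of the factors 1/D are absorbed in the entries N/D and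
the last one remains, so length n contributes ∑_x (M^n)_{x,x}/D_x. Sequences using a non-edge have
weight 0 and can be added freely. -/
theorem tsum_weight [Fintype X] [DecidableEq X] {N : Matrix X X ℝ}
    (hNG : ∀ x y, ¬ G.Adj x y → N x y = 0) {D : X → ℝ} (hD : ∀ x, 0 < D x)
    (h : Subcritical (of fun x y => N x y / D x)) :
    ∑' d : DiscreteLoop G, ENNReal.ofReal (d.weight N D) =
      ENNReal.ofReal (diagonal D - N)⁻¹.trace := by
  set M : Matrix X X ℝ := of fun x y => N x y / D x with hM
  have hs := hasSum_trace_inv_diagonal_sub hD h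
  rw [← hs.tsum_eq, ENNReal.ofReal_tsum_of_nonneg
    (fun n => Finset.sum_nonneg fun i _ => div_nonneg (h.pow_nonneg n i i) (hD i).le) hs.summable,
    ← (discreteLoopEquiv G).symm.tsum_eq, ENNReal.tsum_sigma']
  refine tsum_congr fun n => ?_
  let W : (Fin (n + 1) → X) → ℝ := fun p =>
    (∏ i : Fin n, M (p i.castSucc) (p i.succ)) * (D (p (Fin.last n)))⁻¹
  have hW0 (p) : 0 ≤ W p := mul_nonneg (Finset.prod_nonneg fun _ _ => h.nonneg _ _)
    (inv_nonneg.2 (hD _).le)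
  have hweight (q) : ((discreteLoopEquiv G).symm ⟨n, q⟩).weight N D = W q.1 := by
    simp only [DiscreteLoop.weight, W, hM, of_apply, Finset.prod_div_distrib]
    rw [Fin.prod_univ_castSucc, Finset.prod_inv_distrib, div_eq_mul_inv, mul_assoc]
    rfl
  simp only [hweight]
  refine (tsum_subtype {p : Fin (n + 1) → X | (∀ i : Fin n, G.Adj (p i.castSucc) (p i.succ)) ∧
    p 0 = p (Fin.last n)} fun p => ENNReal.ofReal (W p)).trans ?_
  rw [tsum_fintype]
  have hsum : ∑ x, (M ^ n) x x / D x = ∑ p : Fin (n + 1) → X,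
      (if p 0 = p (Fin.last n) then W p else 0) := by
    -- A final weight concentrated at the starting point forces the path to be closed.
    have (x : X) : (M ^ n) x x / D x = ∑ p : Fin (n + 1) → X, (if p 0 = x then
        (∏ i : Fin n, M (p i.castSucc) (p i.succ)) *
          (Pi.single x (D x)⁻¹ : X → ℝ) (p (Fin.last n)) else 0) := by
      rw [sum_paths, mulVec_single]
      simp [div_eq_mul_inv]
    simp only [this]
    rw [Finset.sum_comm]
    refine Finset.sum_congr rfl fun p _ => ?_
    rw [Finset.sum_ite_eq]
    simp only [Finset.mem_univ, if_true, W]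
    by_cases hp : p 0 = p (Fin.last n)
    · rw [if_pos hp, hp, Pi.single_eq_same]
    · rw [if_neg hp, Pi.single_eq_of_ne (Ne.symm hp), mul_zero]
  rw [hsum, ENNReal.ofReal_sum_of_nonneg fun p _ => by split_ifs; exacts [hW0 p, le_rfl]]
  refine Finset.sum_congr rfl fun p _ => ?_
  by_cases hp : p 0 = p (Fin.last n)
  · rw [if_pos hp]
    by_cases hadj : ∀ i : Fin n, G.Adj (p i.castSucc) (p i.succ)
    · rw [Set.indicator_of_mem]
      exact ⟨hadj, hp⟩
    · rw [Set.indicator_of_notMem fun h => hadj h.1]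
      obtain ⟨i, hi⟩ := not_forall.1 hadj
      have : M (p i.castSucc) (p i.succ) = 0 := by
        rw [hM, of_apply, hNG _ _ hi, zero_div]
      simp only [W]
      rw [Finset.prod_eq_zero (Finset.mem_univ i) this, zero_mul, ENNReal.ofReal_zero]
  · rw [if_neg hp, Set.indicator_of_notMem fun h => hp h.2, ENNReal.ofReal_zero]

end DiscreteLoop

/-! ### Integration against the loop measure -/

section Measurability

variable {X : Type*} {G : SimpleGraph X} {β : Type*} [MeasurableSpace β]

theorem measurable_basedLoop {f : BasedLoop G → β}
    (h : ∀ d : DiscreteLoop G, Measurable fun τ => f ⟨d, τ⟩) : Measurable f := fun _ ht =>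
  MeasurableSpace.measurableSet_iInf.2 fun d => h d ht

theorem measurable_basedLoop_mk (d : DiscreteLoop G) :
    Measurable (fun τ => (⟨d, τ⟩ : BasedLoop G)) := fun _ ht =>
  MeasurableSpace.measurableSet_iInf.1 ht d

theorem measurable_loop {f : Loop G → β}
    (h : Measurable fun l : BasedLoop G => f (Quot.mk _ l)) : Measurable f := fun _ ht => h ht

theorem measurable_loop_mk : Measurable (fun l : BasedLoop G => (Quot.mk _ l : Loop G)) :=
  fun _ ht => ht

variable [DecidableEq X]

theorem measurable_jumps (x y : X) : Measurable fun l : Loop G => l.jumps x y :=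
  measurable_loop (measurable_basedLoop fun d => measurable_const
    (a := ∑ i : Fin d.n, if d.pt i.castSucc = x ∧ d.pt i.succ = y then 1 else 0))

theorem measurable_timeSpent (x : X) : Measurable fun l : Loop G => l.timeSpent x := by
  refine measurable_loop (measurable_basedLoop fun d => ?_)
  change Measurable fun τ : Fin (d.n + 1) → Set.Ioi (0 : ℝ) =>
    ∑ i, if d.pt i = x then (τ i : ℝ) else 0
  refine Finset.measurable_sum _ fun i _ => ?_
  split_ifs
  · exact measurable_subtype_coe.comp (measurable_pi_apply i)
  · exact measurable_const

end Measurability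

instance : SigmaFinite ((volume : Measure ℝ).comap (Subtype.val : Set.Ioi (0 : ℝ) → ℝ)) := by
  have : SigmaFinite (((volume : Measure ℝ).comap
      (Subtype.val : Set.Ioi (0 : ℝ) → ℝ)).map Subtype.val) := by
    rw [map_comap_subtype_coe measurableSet_Ioi]
    infer_instance
  exact SigmaFinite.of_map _ measurable_subtype_coe.aemeasurable this

theorem lintegral_ofReal_prod {ι : Type*} [Fintype ι] {E : Type*} [MeasurableSpace E]
    {μ : ι → Measure E} [∀ i, SigmaFinite (μ i)] {f : ι → E → ℝ} (h0 : ∀ i, 0 ≤ f i)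
    (hf : ∀ i, Integrable (f i) (μ i)) :
    ∫⁻ x, ENNReal.ofReal (∏ i, f i (x i)) ∂Measure.pi μ = ENNReal.ofReal (∏ i, ∫ x, f i x ∂μ i) := by
  rw [← integral_fintype_prod_eq_prod, ofReal_integral_eq_lintegral_ofReal
    (Integrable.fintype_prod hf) (.of_forall fun x => Finset.prod_nonneg fun i _ => h0 i _)]

theorem lintegral_exp_neg_sum {n : ℕ} {c : Fin n → ℝ} (hc : ∀ i, 0 < c i) :
    ∫⁻ τ : Fin n → Set.Ioi (0 : ℝ), ENNReal.ofReal (Real.exp (-∑ i, c i * τ i))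
      ∂(Measure.pi fun _ => (volume : Measure ℝ).comap Subtype.val) =
      ENNReal.ofReal (∏ i, (c i)⁻¹) := by
  have h1 (i : Fin n) : ∫ x : Set.Ioi (0 : ℝ), Real.exp (-c i * x)
      ∂((volume : Measure ℝ).comap Subtype.val) = (c i)⁻¹ := by
    rw [integral_subtype_comap measurableSet_Ioi fun x : ℝ => Real.exp (-c i * x),
      integral_exp_mul_Ioi (neg_lt_zero.2 (hc i))]
    simp
  have h2 (i : Fin n) : Integrable (fun x : Set.Ioi (0 : ℝ) => Real.exp (-c i * x))
      ((volume : Measure ℝ).comap Subtype.val) := by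
    have := integrableOn_exp_mul_Ioi (neg_lt_zero.2 (hc i)) 0
    rw [IntegrableOn, ← map_comap_subtype_coe measurableSet_Ioi] at this
    exact (MeasurableEmbedding.subtype_coe measurableSet_Ioi).integrable_map_iff.1 this
  have := lintegral_ofReal_prod (f := fun i (x : Set.Ioi (0 : ℝ)) => Real.exp (-c i * x))
    (fun i x => (Real.exp_pos _).le) h2
  simp only [h1, ← Real.exp_sum] at this
  rw [← this]
  simp


/-! ### The Laplace exponent of the loop measure as a ratio of determinants -/

section LoopMeasure

open Matrix

variable {X : Type*} {G : SimpleGraph X} {C : Sym2 X → ℝ} {κ : X → ℝ}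

theorem lintegral_loopMeasure [Fintype X] {f : Loop G → ℝ≥0∞} (hf : Measurable f) :
    ∫⁻ l, f l ∂loopMeasure G C κ = ∑' d : DiscreteLoop G, ∫⁻ τ : Fin (d.n + 1) → Set.Ioi (0 : ℝ),
      ENNReal.ofReal ((∏ i : Fin d.n, transitionMatrix C κ (d.pt i.castSucc) (d.pt i.succ)) *
        Real.exp (-∑ i, (τ i : ℝ)) / ∑ i, (τ i : ℝ)) * f (Quot.mk _ ⟨d, τ⟩)
      ∂(Measure.pi fun _ => (volume : Measure ℝ).comap Subtype.val) := by
  have hf' : Measurable fun l : BasedLoop G => f (Quot.mk _ l) := hf.comp measurable_loop_mk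
  rw [loopMeasure, lintegral_map hf measurable_loop_mk, basedLoopMeasure, lintegral_sum_measure]
  refine tsum_congr fun d => ?_
  rw [lintegral_map hf' (measurable_basedLoop_mk d), lintegral_withDensity_eq_lintegral_mul]
  · rfl
  · fun_prop
  · exact hf'.comp (measurable_basedLoop_mk d)

theorem tsum_ennreal_sub {ι : Type*} {f g : ι → ℝ≥0∞} (hg : ∑' i, g i ≠ ∞) (hle : ∀ i, g i ≤ f i) :
    ∑' i, (f i - g i) = ∑' i, f i - ∑' i, g i := by
  refine ENNReal.eq_sub_of_add_eq hg ?_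
  rw [← ENNReal.tsum_add]
  exact tsum_congr fun i => tsub_add_cancel_of_le (hle i)

theorem lintegral_Ioi_ofReal_mul_exp {K T : ℝ} (hK : 0 ≤ K) (hT : 0 < T) :
    ∫⁻ r : ℝ in Set.Ioi 0, ENNReal.ofReal (K * Real.exp (-T * r)) = ENNReal.ofReal (K / T) := by
  rw [← ofReal_integral_eq_lintegral_ofReal
    ((integrableOn_exp_mul_Ioi (neg_lt_zero.2 hT) 0).const_mul K)
    (.of_forall fun r => mul_nonneg hK (Real.exp_pos _).le), integral_const_mul,
    integral_exp_mul_Ioi (neg_lt_zero.2 hT)]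
  congr 1
  simp [div_eq_mul_inv]

/-- The contribution of a discrete loop to the Laplace exponent of the loop measure, where `a` and
`c` are the costs of jumps and of unit sojourns. -/
theorem lintegral_one_sub_exp_discreteLoop {P : Matrix X X ℝ} (hP : ∀ x y, 0 ≤ P x y)
    {a : X → X → ℝ} (ha : ∀ x y, 0 ≤ a x y) {c : X → ℝ} (hc : ∀ x, 0 ≤ c x) (d : DiscreteLoop G) :
    ∫⁻ τ : Fin (d.n + 1) → Set.Ioi (0 : ℝ),
      ENNReal.ofReal ((∏ i : Fin d.n, P (d.pt i.castSucc) (d.pt i.succ)) *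
        Real.exp (-∑ i, (τ i : ℝ)) / ∑ i, (τ i : ℝ)) *
      (1 - ENNReal.ofReal (Real.exp (-(∑ i : Fin d.n, a (d.pt i.castSucc) (d.pt i.succ) +
        ∑ i, c (d.pt i) * τ i)))) ∂(Measure.pi fun _ => (volume : Measure ℝ).comap Subtype.val) =
    ∫⁻ r : ℝ in Set.Ioi 0, (ENNReal.ofReal (d.weight P fun _ => 1 + r) -
      ENNReal.ofReal (d.weight (of fun x y => P x y * Real.exp (-a x y))
        fun x => 1 + c x + r)) := by
  set p : ℝ := ∏ i : Fin d.n, P (d.pt i.castSucc) (d.pt i.succ) with hp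
  set s : ℝ := ∑ i : Fin d.n, a (d.pt i.castSucc) (d.pt i.succ) with hs
  have hp0 : 0 ≤ p := Finset.prod_nonneg fun _ _ => hP _ _
  have hs0 : 0 ≤ s := Finset.sum_nonneg fun _ _ => ha _ _
  have hN : ∏ i : Fin d.n, (of fun x y => P x y * Real.exp (-a x y) : Matrix X X ℝ)
      (d.pt i.castSucc) (d.pt i.succ) = p * Real.exp (-s) := by
    simp only [of_apply, Finset.prod_mul_distrib, hp, hs, ← Finset.sum_neg_distrib, Real.exp_sum]
  let u : ℝ → (Fin (d.n + 1) → Set.Ioi (0 : ℝ)) → ℝ := fun r τ =>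
    Real.exp (-∑ i, (1 + r) * (τ i : ℝ))
  let v : ℝ → (Fin (d.n + 1) → Set.Ioi (0 : ℝ)) → ℝ := fun r τ =>
    Real.exp (-∑ i, (1 + c (d.pt i) + r) * (τ i : ℝ))
  have hu (r : ℝ) : Measurable (u r) := by fun_prop
  have hv (r : ℝ) : Measurable (v r) := by fun_prop
  have hvu (r : ℝ) (τ) : Real.exp (-s) * v r τ ≤ u r τ := by
    refine (mul_le_of_le_one_left (Real.exp_pos _).le (Real.exp_le_one_iff.2 (by linarith))).trans
      (Real.exp_le_exp.2 (neg_le_neg (Finset.sum_le_sum fun i _ => ?_)))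
    exact mul_le_mul_of_nonneg_right (by linarith [hc (d.pt i)]) (τ i).2.le
  -- The factor 1/T, with T the total duration, is ∫₀^∞ e^{-rT} dr. It only adds r to the rate of
  -- every sojourn, so for fixed r the integrand is a difference of products over the sojourns.
  have h1 (τ : Fin (d.n + 1) → Set.Ioi (0 : ℝ)) :
      ENNReal.ofReal (p * Real.exp (-∑ i, (τ i : ℝ)) / ∑ i, (τ i : ℝ)) *
        (1 - ENNReal.ofReal (Real.exp (-(s + ∑ i, c (d.pt i) * τ i)))) =
      ∫⁻ r : ℝ in Set.Ioi 0, ENNReal.ofReal (p * (u r τ - Real.exp (-s) * v r τ)) := by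
    have hT : 0 < ∑ i, (τ i : ℝ) := Finset.sum_pos (fun i _ => (τ i).2) Finset.univ_nonempty
    have hcτ : 0 ≤ ∑ i, c (d.pt i) * τ i :=
      Finset.sum_nonneg fun i _ => mul_nonneg (hc _) (τ i).2.le
    have hle : Real.exp (-(s + ∑ i, c (d.pt i) * τ i)) ≤ 1 :=
      Real.exp_le_one_iff.2 (by linarith)
    rw [← ENNReal.ofReal_one, ← ENNReal.ofReal_sub _ (Real.exp_pos _).le,
      ← ENNReal.ofReal_mul (by positivity), div_mul_eq_mul_div,
      ← lintegral_Ioi_ofReal_mul_exp (mul_nonneg (by positivity) (sub_nonneg.2 hle)) hT]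
    refine lintegral_congr fun r => congrArg _ ?_
    have e1 : u r τ = Real.exp (-∑ i, (τ i : ℝ)) * Real.exp (-(∑ i, (τ i : ℝ)) * r) := by
      rw [← Real.exp_add]
      simp only [u, ← Finset.mul_sum]
      congr 1
      ring
    have e2 : Real.exp (-s) * v r τ = Real.exp (-∑ i, (τ i : ℝ)) *
        Real.exp (-(s + ∑ i, c (d.pt i) * τ i)) * Real.exp (-(∑ i, (τ i : ℝ)) * r) := by
      rw [← Real.exp_add, ← Real.exp_add, ← Real.exp_add]
      simp only [add_mul, Finset.sum_add_distrib, ← Finset.mul_sum]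
      congr 1
      ring
    rw [e1, e2]
    ring
  simp only [h1]
  rw [lintegral_lintegral_swap (by fun_prop)]
  refine setLIntegral_congr_fun measurableSet_Ioi fun r hr => ?_
  have hr0 : 0 < r := hr
  have hI0 := lintegral_exp_neg_sum (c := fun _ : Fin (d.n + 1) => 1 + r) fun _ => by positivity
  have hI1 := lintegral_exp_neg_sum (c := fun i : Fin (d.n + 1) => 1 + c (d.pt i) + r)
    fun i => by linarith [hc (d.pt i)]
  have hps : 0 ≤ p * Real.exp (-s) := by positivity
  simp only [DiscreteLoop.weight, hN, ← hp]
  rw [ENNReal.ofReal_mul hp0, ENNReal.ofReal_mul hps, ← hI0, ← hI1,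
    ← lintegral_const_mul _ (by fun_prop), ← lintegral_const_mul _ (by fun_prop),
    ← lintegral_sub (by fun_prop)]
  · refine lintegral_congr fun τ => ?_
    rw [← ENNReal.ofReal_mul hp0, ← ENNReal.ofReal_mul hps,
      ← ENNReal.ofReal_sub _ (mul_nonneg hps (Real.exp_pos _).le)]
    congr 1
    simp only [u, v]
    ring
  · rw [lintegral_const_mul _ (by fun_prop), hI1]
    exact ENNReal.mul_ne_top ENNReal.ofReal_ne_top ENNReal.ofReal_ne_top
  · refine .of_forall fun τ => ?_
    dsimp only
    rw [← ENNReal.ofReal_mul hp0, ← ENNReal.ofReal_mul hps]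
    refine ENNReal.ofReal_le_ofReal ?_
    rw [mul_assoc]
    exact mul_le_mul_of_nonneg_left (hvu r τ) hp0

variable [Fintype X] [DecidableEq X]

/-- The linear functional `∑ a_{x,y} N_{x,y} + ∑ b_x L̂_x` of a loop. -/
noncomputable def loopExponent (C : Sym2 X → ℝ) (κ : X → ℝ) (a : X → X → ℝ≥0) (b : X → ℝ≥0)
    (l : Loop G) : ℝ≥0∞ :=
  ∑ x, ∑ y, a x y * (l.jumps x y : ℝ≥0∞) +
    ∑ x, b x * (ENNReal.ofReal (l.timeSpent x) / ENNReal.ofReal (dualityMeasure C κ x))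

theorem measurable_loopExponent (a : X → X → ℝ≥0) (b : X → ℝ≥0) :
    Measurable (loopExponent (G := G) C κ a b) := by
  refine .add (Finset.measurable_sum _ fun x _ => Finset.measurable_sum _ fun y _ => ?_)
    (Finset.measurable_sum _ fun x _ => ?_)
  · exact ((measurable_of_countable _).comp (measurable_jumps x y)).const_mul _
  · exact ((measurable_timeSpent x).ennreal_ofReal.div_const _).const_mul _

/-- Sums over sites and pairs of sites are reorganised as sums along the loop, so that the
exponential becomes a product over its jumps and sojourns. -/
theorem loopExponent_mk (hpos : ∀ x, 0 < dualityMeasure C κ x) (a : X → X → ℝ≥0) (b : X → ℝ≥0)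
    (d : DiscreteLoop G) (τ : Fin (d.n + 1) → Set.Ioi (0 : ℝ)) :
    loopExponent C κ a b (Quot.mk _ ⟨d, τ⟩) =
      ENNReal.ofReal (∑ i : Fin d.n, (a (d.pt i.castSucc) (d.pt i.succ) : ℝ) +
        ∑ i, (b (d.pt i) / dualityMeasure C κ (d.pt i)) * τ i) := by
  have h1 : ∑ x, ∑ y, (a x y : ℝ≥0∞) *
      (Loop.jumps (G := G) (Quot.mk _ ⟨d, τ⟩) x y : ℝ≥0∞) =
      ∑ i : Fin d.n, (a (d.pt i.castSucc) (d.pt i.succ) : ℝ≥0∞) := by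
    change ∑ x, ∑ y, (a x y : ℝ≥0∞) * ((∑ i : Fin d.n,
      if d.pt i.castSucc = x ∧ d.pt i.succ = y then 1 else 0 : ℕ) : ℝ≥0∞) = _
    simp only [Nat.cast_sum, Nat.cast_ite, Nat.cast_one, Nat.cast_zero, Finset.mul_sum, mul_ite,
      mul_one, mul_zero, ite_and]
    rw [Finset.sum_congr rfl fun x _ => Finset.sum_comm, Finset.sum_comm]
    refine Finset.sum_congr rfl fun i _ => ?_
    simp
  have h2 : ∑ x, (b x : ℝ≥0∞) * (ENNReal.ofReal (Loop.timeSpent (G := G) (Quot.mk _ ⟨d, τ⟩) x) /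
      ENNReal.ofReal (dualityMeasure C κ x)) =
      ENNReal.ofReal (∑ i, (b (d.pt i) / dualityMeasure C κ (d.pt i)) * τ i) := by
    change ∑ x, (b x : ℝ≥0∞) * (ENNReal.ofReal (∑ i, if d.pt i = x then (τ i : ℝ) else 0) /
      ENNReal.ofReal (dualityMeasure C κ x)) = _
    have h0 (x : X) (i) : 0 ≤ if d.pt i = x then (τ i : ℝ) else 0 := by
      split_ifs
      exacts [(τ i).2.le, le_rfl]
    have (x : X) : (b x : ℝ≥0∞) * (ENNReal.ofReal (∑ i, if d.pt i = x then (τ i : ℝ) else 0) /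
        ENNReal.ofReal (dualityMeasure C κ x)) = ENNReal.ofReal
        (b x * ((∑ i, if d.pt i = x then (τ i : ℝ) else 0) / dualityMeasure C κ x)) := by
      rw [← ENNReal.ofReal_div_of_pos (hpos x), ENNReal.ofReal_mul (b x).coe_nonneg,
        ENNReal.ofReal_coe_nnreal]
    simp only [this]
    rw [← ENNReal.ofReal_sum_of_nonneg fun x _ => mul_nonneg (b x).coe_nonneg
      (div_nonneg (Finset.sum_nonneg fun i _ => h0 x i) (hpos x).le)]
    congr 1
    simp only [Finset.sum_div, Finset.mul_sum]
    rw [Finset.sum_comm]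
    refine Finset.sum_congr rfl fun i _ => ?_
    rw [Finset.sum_eq_single (d.pt i)]
    · rw [if_pos rfl]
      ring
    · intro x _ hx
      rw [if_neg hx.symm, zero_div, mul_zero]
    · exact fun h => absurd (Finset.mem_univ _) h
  have h3 : ∑ i : Fin d.n, (a (d.pt i.castSucc) (d.pt i.succ) : ℝ≥0∞) =
      ENNReal.ofReal (∑ i : Fin d.n, (a (d.pt i.castSucc) (d.pt i.succ) : ℝ)) := by
    rw [ENNReal.ofReal_sum_of_nonneg fun i _ => NNReal.coe_nonneg _]
    simp only [ENNReal.ofReal_coe_nnreal]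
  refine (congrArg₂ (· + ·) (h1.trans h3) h2).trans (ENNReal.ofReal_add (by positivity) ?_).symm
  exact Finset.sum_nonneg fun i _ => mul_nonneg
    (div_nonneg (NNReal.coe_nonneg _) (hpos _).le) (τ i).2.le

/-- The jump rates of the loops, damped by the factors `e^{-a}`. -/
noncomputable def dampedMatrix (C : Sym2 X → ℝ) (κ : X → ℝ) (a : X → X → ℝ≥0) : Matrix X X ℝ :=
  of fun x y => transitionMatrix C κ x y * Real.exp (-a x y)

/-- The Laplace exponent of the loop measure. -/
theorem expNeg_lintegral_loopMeasure (hC : ∀ e, 0 ≤ C e) (hCG : ∀ e, e ∉ G.edgeSet → C e = 0)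
    (hE : ∀ f : X → ℝ, f ≠ 0 → 0 < energy C κ f) (a : X → X → ℝ≥0) (b : X → ℝ≥0) :
    ∫⁻ l, (1 - expNeg (loopExponent C κ a b l)) ∂loopMeasure G C κ ≠ ∞ ∧
    expNeg (∫⁻ l, (1 - expNeg (loopExponent C κ a b l)) ∂loopMeasure G C κ) =
      ENNReal.ofReal ((1 - transitionMatrix C κ).det /
        (diagonal (fun x => 1 + b x / dualityMeasure C κ x) - dampedMatrix C κ a).det) := by
  have hpos := dualityMeasure_pos hC hE
  have hP := subcritical_transitionMatrix hC hE
  set P := transitionMatrix C κ with hPdef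
  set N := dampedMatrix C κ a with hNdef
  set c : X → ℝ := fun x => b x / dualityMeasure C κ x with hcdef
  have hc (x) : 0 ≤ c x := div_nonneg (b x).coe_nonneg (hpos x).le
  have hN0 (x y) : 0 ≤ N x y := mul_nonneg (hP.nonneg x y) (Real.exp_pos _).le
  have hNP (x y) : N x y ≤ P x y := mul_le_of_le_one_right (hP.nonneg x y)
    (Real.exp_le_one_iff.2 (neg_nonpos.2 (a x y).coe_nonneg))
  have hPG (x y) (h : ¬ G.Adj x y) : P x y = 0 := by
    rw [hPdef, transitionMatrix, of_apply, hCG _ h, zero_div]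
  have hNG (x y) (h : ¬ G.Adj x y) : N x y = 0 := by
    rw [hNdef, dampedMatrix, of_apply, ← hPdef, hPG x y h, zero_mul]
  -- Every matrix needed below is dominated entrywise by P, hence subcritical.
  have hsub {K : Matrix X X ℝ} (hK0 : ∀ x y, 0 ≤ K x y) (hKP : ∀ x y, K x y ≤ P x y) {D : X → ℝ}
      (hD : ∀ x, 1 ≤ D x) : Subcritical (of fun x y => K x y / D x) :=
    hP.mono (fun x y => div_nonneg (hK0 x y) (zero_le_one.trans (hD x)))
      fun x y => (div_le_self (hK0 x y) (hD x)).trans (hKP x y)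
  have hD0 {r : ℝ} (hr : 0 ≤ r) (x : X) : 1 ≤ (fun _ : X => 1 + r) x := by simpa using hr
  have hD1 {r : ℝ} (hr : 0 ≤ r) (x : X) : 1 ≤ (fun x : X => 1 + c x + r) x := by
    have := hc x
    dsimp only
    linarith
  have hM0 (r : ℝ) : r • (1 : Matrix X X ℝ) + (1 - P) = diagonal (fun _ => 1 + r) - P := by
    rw [smul_one_eq_diagonal, ← diagonal_one, add_sub_assoc', diagonal_add]
    simp only [add_comm]
  have hM1 (r : ℝ) : r • (1 : Matrix X X ℝ) + (diagonal (fun x => 1 + c x) - N) =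
      diagonal (fun x => 1 + c x + r) - N := by
    rw [smul_one_eq_diagonal, add_sub_assoc', diagonal_add]
    simp only [add_comm r]
  have hpos1 {D : X → ℝ} (hD : ∀ x, 1 ≤ D x) (x) : 0 < D x := zero_lt_one.trans_le (hD x)
  have hs0 {r : ℝ} (hr : 0 ≤ r) := hsub hP.nonneg (fun _ _ => le_rfl) (hD0 hr)
  have hs1 {r : ℝ} (hr : 0 ≤ r) := hsub hN0 hNP (hD1 hr)
  have ht0 {r : ℝ} (hr : 0 ≤ r) := tsum_weight (G := G) hPG (hpos1 (hD0 hr)) (hs0 hr)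
  have ht1 {r : ℝ} (hr : 0 ≤ r) := tsum_weight (G := G) hNG (hpos1 (hD1 hr)) (hs1 hr)
  have hw {r : ℝ} (hr : 0 ≤ r) (d : DiscreteLoop G) :
      d.weight N (fun x => 1 + c x + r) ≤ d.weight P (fun _ => 1 + r) := by
    refine mul_le_mul (Finset.prod_le_prod (fun _ _ => hN0 _ _) fun _ _ => hNP _ _)
      (Finset.prod_le_prod (fun _ _ => inv_nonneg.2 (hpos1 (hD1 hr) _).le) fun i _ => ?_)
      (Finset.prod_nonneg fun _ _ => inv_nonneg.2 (hpos1 (hD1 hr) _).le)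
      (Finset.prod_nonneg fun _ _ => hP.nonneg _ _)
    exact inv_anti₀ (hpos1 (hD0 hr) (d.pt i)) (by linarith [hc (d.pt i)])
  have htr1 {r : ℝ} (hr : 0 ≤ r) : 0 ≤ (diagonal (fun x => 1 + c x + r) - N)⁻¹.trace :=
    (hasSum_trace_inv_diagonal_sub (hpos1 (hD1 hr)) (hs1 hr)).nonneg fun n =>
      Finset.sum_nonneg fun i _ => div_nonneg ((hs1 hr).pow_nonneg n i i) (hpos1 (hD1 hr) i).le
  have htr0 {r : ℝ} (hr : 0 ≤ r) : 0 ≤ (diagonal (fun _ => 1 + r) - P)⁻¹.trace :=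
    (hasSum_trace_inv_diagonal_sub (hpos1 (hD0 hr)) (hs0 hr)).nonneg fun n =>
      Finset.sum_nonneg fun i _ => div_nonneg ((hs0 hr).pow_nonneg n i i) (hpos1 (hD0 hr) i).le
  have key := expNeg_lintegral_trace_inv_sub (1 - P) (diagonal (fun x => 1 + c x) - N)
    (fun r hr => by rw [hM0]; exact det_diagonal_sub_pos (hpos1 (hD0 hr)) (hs0 hr))
    (fun r hr => by rw [hM1]; exact det_diagonal_sub_pos (hpos1 (hD1 hr)) (hs1 hr))
    -- The comparison of the two traces is obtained loop by loop, from their expansions as sums of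
    -- weights.
    (fun r hr => by
      rw [hM0, hM1, ← ENNReal.ofReal_le_ofReal_iff (htr0 hr), ← ht0 hr, ← ht1 hr]
      exact ENNReal.tsum_le_tsum fun d => ENNReal.ofReal_le_ofReal (hw hr d))
  have hZ : ∫⁻ l, (1 - expNeg (loopExponent C κ a b l)) ∂loopMeasure G C κ =
      ∫⁻ r : ℝ in Set.Ioi 0, ENNReal.ofReal ((r • (1 : Matrix X X ℝ) + (1 - P))⁻¹.trace -
        (r • (1 : Matrix X X ℝ) + (diagonal (fun x => 1 + c x) - N))⁻¹.trace) := by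
    have hmeas : Measurable fun l : Loop G => 1 - expNeg (loopExponent C κ a b l) :=
      measurable_const.sub (measurable_expNeg.comp (measurable_loopExponent a b))
    rw [lintegral_loopMeasure hmeas]
    have hd (d : DiscreteLoop G) := lintegral_one_sub_exp_discreteLoop hP.nonneg
      (a := fun x y => a x y) (fun x y => (a x y).coe_nonneg) hc d
    have hex (d : DiscreteLoop G) (τ : Fin (d.n + 1) → Set.Ioi (0 : ℝ)) :
        expNeg (loopExponent C κ a b (Quot.mk _ ⟨d, τ⟩)) =
        ENNReal.ofReal (Real.exp (-(∑ i : Fin d.n, (a (d.pt i.castSucc) (d.pt i.succ) : ℝ) +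
          ∑ i, c (d.pt i) * τ i))) := by
      rw [loopExponent_mk hpos, expNeg_ofReal]
      exact add_nonneg (Finset.sum_nonneg fun _ _ => NNReal.coe_nonneg _)
        (Finset.sum_nonneg fun i _ => mul_nonneg (hc _) (τ i).2.le)
    simp only [hex, ← hPdef, hd]
    rw [← lintegral_tsum]
    · refine setLIntegral_congr_fun measurableSet_Ioi fun r hr => ?_
      have hr0 : 0 ≤ r := le_of_lt hr
      -- For fixed r the subtracted sum is finite, so the sum of the differences is the difference
      -- of the sums.
      have := tsum_ennreal_sub (f := fun d : DiscreteLoop G =>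
        ENNReal.ofReal (d.weight P fun _ => 1 + r))
        (g := fun d => ENNReal.ofReal (d.weight N fun x => 1 + c x + r))
        (by rw [ht1 hr0]; exact ENNReal.ofReal_ne_top)
        (fun d => ENNReal.ofReal_le_ofReal (hw hr0 d))
      rw [ht0 hr0, ht1 hr0] at this
      rw [hM0, hM1, ENNReal.ofReal_sub _ (htr1 hr0)]
      exact this
    · intro d
      simp only [DiscreteLoop.weight]
      fun_prop
  rw [hZ]
  exact key

end LoopMeasure


/-! ### Laplace transforms at integer points determine finite measures -/

section Uniqueness

open BoundedContinuousFunction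

/-- The bounded continuous function `v ↦ e^{-v_k}`. -/
noncomputable def expNegCoord {K : Type*} (k : K) : (K → ℝ≥0∞) →ᵇ ℝ :=
  BoundedContinuousFunction.ofNormedAddCommGroup (fun v => (expNeg (v k)).toReal)
    (ENNReal.continuousOn_toReal.comp_continuous (continuous_expNeg.comp (continuous_apply k))
      fun v => expNeg_ne_top _) 1 fun v => by
    rw [Real.norm_of_nonneg ENNReal.toReal_nonneg]
    exact ENNReal.toReal_le_of_le_ofReal zero_le_one (by simpa using expNeg_le_one (v k))

theorem expNegCoord_apply {K : Type*} (k : K) (v : K → ℝ≥0∞) :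
    expNegCoord k v = (expNeg (v k)).toReal := rfl

/-- The hypothesis says that P and Q agree on all monomials in the functions e^{-v_k}. These are
bounded and continuous on the Polish space [0,∞]^K, with e^{-∞} = 0, and separate its points, so the
algebra they span determines finite measures. -/
theorem measure_ext_of_lintegral_expNeg {K : Type*} [Fintype K] {P Q : Measure (K → ℝ≥0∞)}
    [IsFiniteMeasure P] [IsFiniteMeasure Q]
    (h : ∀ n : K → ℕ, ∫⁻ v, expNeg (∑ k, n k * v k) ∂P = ∫⁻ v, expNeg (∑ k, n k * v k) ∂Q) :
    P = Q := by
  let S : Set ((K → ℝ≥0∞) →ᵇ ℝ) := Set.range expNegCoord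
  have hstar (a : (K → ℝ≥0∞) →ᵇ ℝ) : star a = a :=
    BoundedContinuousFunction.ext fun v => star_trivial (a v)
  let A : StarSubalgebra ℝ ((K → ℝ≥0∞) →ᵇ ℝ) :=
    { Algebra.adjoin ℝ S with star_mem' := fun {a} ha => (hstar a).symm ▸ ha }
  refine ext_of_forall_mem_subalgebra_integral_eq_of_polish (𝕜 := ℝ) (A := A) ?_ ?_
  · intro v w hvw
    obtain ⟨k, hk⟩ := Function.ne_iff.1 hvw
    refine ⟨expNegCoord k, ⟨_, ⟨expNegCoord k, Algebra.subset_adjoin ⟨k, rfl⟩, rfl⟩, rfl⟩, ?_⟩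
    intro heq
    exact hk (expNeg_injective ((ENNReal.toReal_eq_toReal_iff' (expNeg_ne_top _)
      (expNeg_ne_top _)).1 heq))
  · intro g hg
    have hg' : g ∈ Submodule.span ℝ (Submonoid.closure S : Set ((K → ℝ≥0∞) →ᵇ ℝ)) := by
      rw [← Algebra.adjoin_eq_span]
      exact hg
    clear hg
    induction hg' using Submodule.span_induction with
    | mem x hx =>
      have hx' : ∃ n : K → ℕ, x = ∏ k, expNegCoord k ^ n k := by
        induction hx using Submonoid.closure_induction with
        | mem x hx =>
          classical
          obtain ⟨k, rfl⟩ := hx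
          refine ⟨Pi.single k 1, ?_⟩
          rw [Finset.prod_eq_single k]
          · simp
          · intro j _ hj
            simp [hj]
          · exact fun h => absurd (Finset.mem_univ _) h
        | one => exact ⟨0, by simp⟩
        | mul x y _ _ hx hy =>
          obtain ⟨n, rfl⟩ := hx
          obtain ⟨m, rfl⟩ := hy
          exact ⟨n + m, by simp [pow_add, Finset.prod_mul_distrib]⟩
      obtain ⟨n, rfl⟩ := hx'
      have hval (v : K → ℝ≥0∞) : (∏ k, expNegCoord k ^ n k) v =
          (expNeg (∑ k, n k * v k)).toReal := by
        rw [expNeg_sum, ENNReal.toReal_prod]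
        simp only [expNeg_natCast_mul, ENNReal.toReal_pow, ← expNegCoord_apply,
          BoundedContinuousFunction.coe_prod, BoundedContinuousFunction.coe_pow,
          Finset.prod_apply, Pi.pow_apply]
      have hm : Measurable fun v : K → ℝ≥0∞ => expNeg (∑ k, n k * v k) :=
        measurable_expNeg.comp (by fun_prop)
      simp only [hval]
      rw [integral_toReal hm.aemeasurable (.of_forall fun v => (expNeg_ne_top _).lt_top),
        integral_toReal hm.aemeasurable (.of_forall fun v => (expNeg_ne_top _).lt_top), h]
    | zero => simp
    | add x y hx hy hx' hy' =>
      simp only [BoundedContinuousFunction.coe_add, Pi.add_apply]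
      rw [integral_add (x.integrable _) (y.integrable _),
        integral_add (x.integrable _) (y.integrable _), hx', hy']
    | smul c x hx hx' =>
      simp only [BoundedContinuousFunction.coe_smul]
      rw [integral_smul, integral_smul, hx']

end Uniqueness


/-! ### The joint law of the network and of the occupation field -/

section JointLaw

open Matrix

/-- The Gamma integral. The absolute value makes the integrand nonnegative on the whole line, as
`lintegral_ofReal_prod` requires. -/
theorem integral_abs_pow_mul_exp (n : ℕ) {r : ℝ} (hr : 0 < r) :
    ∫ t in Set.Ici (0 : ℝ), |t| ^ n * Real.exp (-(r * t)) = n.factorial / r ^ (n + 1) := by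
  have h := Real.integral_rpow_mul_exp_neg_mul_Ioi (a := n + 1) (by positivity) hr
  rw [Real.Gamma_nat_eq_factorial, add_sub_cancel_right] at h
  rw [integral_Ici_eq_integral_Ioi]
  refine Eq.trans (setIntegral_congr_fun measurableSet_Ioi fun t ht => ?_) (h.trans ?_)
  · have : 0 < t := ht
    simp only [abs_of_pos this, Real.rpow_natCast]
  · rw [← Nat.cast_add_one, Real.rpow_natCast]
    rw [one_div, inv_pow, inv_mul_eq_div]

variable {X : Type*} [Fintype X] [DecidableEq X] (C : Sym2 X → ℝ) (κ : X → ℝ)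

/-- The density of the occupation field on the event that the network is `k`. -/
noncomputable def networkDensity (k : X → X → ℕ) (ρ : X → ℝ) : ℝ :=
  (1 - transitionMatrix C κ).det * (∏ x, ∏ y, C s(x, y) ^ k x y / (k x y).factorial) *
    ∏ x, ρ x ^ (∑ y, k x y) *
      (dualityMeasure C κ x * Real.exp (-(dualityMeasure C κ x * ρ x)))

/-- The values of a network and of an occupation field, listed together. -/
noncomputable def coords (k : X → X → ℕ) (ρ : X → ℝ) : (X × X) ⊕ X → ℝ≥0∞ :=
  Sum.elim (fun p => (k p.1 p.2 : ℝ≥0∞)) fun x => ENNReal.ofReal (ρ x)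

/-- The joint law of the network and of the occupation field. -/
noncomputable def jointLaw : Measure ((X × X) ⊕ X → ℝ≥0∞) :=
  Measure.sum fun k : balanced X =>
    ((volume.restrict {ρ : X → ℝ | ∀ x, 0 ≤ ρ x}).withDensity fun ρ =>
      ENNReal.ofReal (networkDensity C κ k ρ)).map (coords k.1)

theorem measurable_coords {X : Type*} (k : X → X → ℕ) : Measurable (coords k) := by
  refine measurable_pi_lambda _ fun i => ?_
  rcases i with p | x
  · exact measurable_const
  · exact (measurable_pi_apply x).ennreal_ofReal

theorem measurable_networkDensity (k : X → X → ℕ) : Measurable (networkDensity C κ k) := by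
  unfold networkDensity
  fun_prop

theorem lintegral_jointLaw {f : ((X × X) ⊕ X → ℝ≥0∞) → ℝ≥0∞} (hf : Measurable f) :
    ∫⁻ v, f v ∂jointLaw C κ = ∑' k : balanced X, ∫⁻ ρ in {ρ : X → ℝ | ∀ x, 0 ≤ ρ x},
      ENNReal.ofReal (networkDensity C κ k ρ) * f (coords k ρ) := by
  rw [jointLaw, lintegral_sum_measure]
  refine tsum_congr fun k => ?_
  rw [lintegral_map hf (measurable_coords _)]
  exact lintegral_withDensity_eq_lintegral_mul _
    (measurable_networkDensity C κ k).ennreal_ofReal (hf.comp (measurable_coords k.1))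

variable {C κ}

theorem measurableSet_nonneg {X : Type*} [Fintype X] : MeasurableSet {ρ : X → ℝ | ∀ x, 0 ≤ ρ x} := by
  simp only [Set.ofPred_forall]
  exact MeasurableSet.iInter fun x => measurableSet_le measurable_const (measurable_pi_apply x)

/-- With k_x = ∑_y k_{x,y}, the Gamma integral at x gives k_x! / (λ_x + n_x)^{k_x+1}. Of these k_x +
1 factors, k_x normalise the jumps out of x into the entries of the damped matrix over 1 + n_x/λ_x.
The remaining one, multiplied by λ_x, is (1 + n_x/λ_x)⁻¹. -/
theorem lintegral_networkDensity_mul_expNeg (hC : ∀ e, 0 ≤ C e)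
    (hE : ∀ f : X → ℝ, f ≠ 0 → 0 < energy C κ f) (n : (X × X) ⊕ X → ℕ) (k : X → X → ℕ) :
    ∫⁻ ρ in {ρ : X → ℝ | ∀ x, 0 ≤ ρ x},
      ENNReal.ofReal (networkDensity C κ k ρ) * expNeg (∑ i, n i * coords k ρ i) =
    ENNReal.ofReal ((1 - transitionMatrix C κ).det *
      ∏ x, (1 + n (Sum.inr x) / dualityMeasure C κ x)⁻¹) *
    ENNReal.ofReal (networkWeight (of fun x y =>
      dampedMatrix C κ (fun x y => n (Sum.inl (x, y))) x y /
        (1 + n (Sum.inr x) / dualityMeasure C κ x)) k) := by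
  have hpos := dualityMeasure_pos hC hE
  have hdet := (subcritical_transitionMatrix hC hE).det_pos
  set δ := (1 - transitionMatrix C κ).det
  set lam := dualityMeasure C κ with hlam
  let K : ℝ := δ * ∏ x, ∏ y, (C s(x, y) ^ k x y / (k x y).factorial *
    Real.exp (-(n (Sum.inl (x, y)) * k x y)))
  let φ : X → ℝ → ℝ := fun x t =>
    lam x * (|t| ^ (∑ y, k x y) * Real.exp (-((lam x + n (Sum.inr x)) * t)))
  have hr (x : X) : 0 < lam x + n (Sum.inr x) := add_pos_of_pos_of_nonneg (hpos x) (by positivity)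
  have hK : 0 ≤ K := mul_nonneg hdet.le (Finset.prod_nonneg fun x _ => Finset.prod_nonneg
    fun y _ => mul_nonneg (div_nonneg (pow_nonneg (hC _) _) (by positivity)) (Real.exp_pos _).le)
  have hφ0 (x : X) : 0 ≤ φ x := fun t => mul_nonneg (hpos x).le (by positivity)
  have hφint (x : X) : ∫ t in Set.Ici (0 : ℝ), φ x t =
      lam x * ((∑ y, k x y).factorial / (lam x + n (Sum.inr x)) ^ (∑ y, k x y + 1)) := by
    rw [integral_const_mul, integral_abs_pow_mul_exp _ (hr x)]
  have hφi (x : X) : Integrable (φ x) (volume.restrict (Set.Ici (0 : ℝ))) := by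
    -- The integral of a non-integrable function is 0 by convention, so a nonzero value proves
    -- integrability.
    refine not_imp_comm.1 integral_undef ?_
    rw [hφint]
    have := hpos x
    have := hr x
    positivity
  have hset : {ρ : X → ℝ | ∀ x, 0 ≤ ρ x} = Set.univ.pi fun _ => Set.Ici (0 : ℝ) := by
    ext ρ
    simp [Pi.le_def]
  calc _ = ∫⁻ ρ in {ρ : X → ℝ | ∀ x, 0 ≤ ρ x}, ENNReal.ofReal K * ENNReal.ofReal (∏ x, φ x (ρ x)) := by
        refine setLIntegral_congr_fun measurableSet_nonneg fun ρ hρ => ?_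
        have hρ' : ∀ x, 0 ≤ ρ x := hρ
        have hsum : ∑ i, (n i : ℝ≥0∞) * coords k ρ i = ENNReal.ofReal
            (∑ x, ∑ y, (n (Sum.inl (x, y)) : ℝ) * k x y + ∑ x, n (Sum.inr x) * ρ x) := by
          rw [Fintype.sum_sum_type, Fintype.sum_prod_type, ENNReal.ofReal_add (by positivity)
            (Finset.sum_nonneg fun x _ => mul_nonneg (by positivity) (hρ' x)),
            ENNReal.ofReal_sum_of_nonneg fun x _ => by positivity,
            ENNReal.ofReal_sum_of_nonneg fun x _ => mul_nonneg (by positivity) (hρ' x)]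
          congr 1
          · refine Finset.sum_congr rfl fun x _ => ?_
            rw [ENNReal.ofReal_sum_of_nonneg fun x _ => by positivity]
            refine Finset.sum_congr rfl fun y _ => ?_
            rw [ENNReal.ofReal_mul (by positivity), ENNReal.ofReal_natCast,
              ENNReal.ofReal_natCast]
            rfl
          · refine Finset.sum_congr rfl fun x _ => ?_
            rw [ENNReal.ofReal_mul (by positivity), ENNReal.ofReal_natCast]
            rfl
        have hsum0 : 0 ≤ ∑ x, ∑ y, (n (Sum.inl (x, y)) : ℝ) * k x y +
            ∑ x, n (Sum.inr x) * ρ x := add_nonneg (by positivity)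
          (Finset.sum_nonneg fun x _ => mul_nonneg (by positivity) (hρ' x))
        rw [hsum, expNeg_ofReal hsum0, ← ENNReal.ofReal_mul' (Real.exp_pos _).le,
          ← ENNReal.ofReal_mul hK]
        congr 1
        simp only [networkDensity, K, φ, neg_add, Real.exp_add, ← Finset.sum_neg_distrib,
          Real.exp_sum, add_mul, Finset.prod_mul_distrib, abs_of_nonneg (hρ' _), ← hlam]
        ring
    _ = ENNReal.ofReal (K * ∏ x, (lam x * ((∑ y, k x y).factorial /
          (lam x + n (Sum.inr x)) ^ (∑ y, k x y + 1)))) := by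
        rw [lintegral_const_mul, hset, volume_pi, Measure.restrict_pi_pi,
          lintegral_ofReal_prod hφ0 hφi, ← ENNReal.ofReal_mul hK]
        · simp only [hφint]
        · fun_prop
    _ = _ := by
        rw [← ENNReal.ofReal_mul (mul_nonneg hdet.le (Finset.prod_nonneg fun x _ => inv_nonneg.2
          (add_nonneg zero_le_one (div_nonneg (by positivity) (hpos x).le))))]
        congr 1
        simp only [K, networkWeight]
        rw [mul_assoc, mul_assoc, ← Finset.prod_mul_distrib, ← Finset.prod_mul_distrib]
        congr 1
        refine Finset.prod_congr rfl fun x _ => ?_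
        have h1 := (hpos x).ne'
        have h2 := (hr x).ne'
        have hM (y : X) : dampedMatrix C κ (fun x y => (n (Sum.inl (x, y)) : ℝ≥0)) x y /
            (1 + n (Sum.inr x) / lam x) =
            C s(x, y) * Real.exp (-n (Sum.inl (x, y))) / (lam x + n (Sum.inr x)) := by
          simp only [dampedMatrix, transitionMatrix, of_apply, ← hlam, NNReal.coe_natCast]
          field_simp
        simp only [of_apply, hM, div_pow, mul_pow, ← Real.exp_nat_mul]
        simp only [div_div, mul_comm (_ ^ _) ((Nat.factorial _ : ℕ) : ℝ)]
        have hexp (y : X) : (k x y : ℝ) * -(n (Sum.inl (x, y)) : ℝ) =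
          -(n (Sum.inl (x, y)) * k x y) := by ring
        simp only [hexp, Finset.prod_div_distrib, Finset.prod_mul_distrib,
          Finset.prod_pow_eq_pow_sum]
        have h3 : (∏ y, ((k x y).factorial : ℝ)) ≠ 0 :=
          Finset.prod_ne_zero_iff.2 fun y _ => by positivity
        rw [pow_succ]
        field_simp

/-- The Laplace transform of the joint law, at integer points. -/
theorem lintegral_expNeg_jointLaw (hC : ∀ e, 0 ≤ C e)
    (hE : ∀ f : X → ℝ, f ≠ 0 → 0 < energy C κ f) (n : (X × X) ⊕ X → ℕ) :
    ∫⁻ v, expNeg (∑ i, n i * v i) ∂jointLaw C κ =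
      ENNReal.ofReal ((1 - transitionMatrix C κ).det /
        (diagonal (fun x => 1 + n (Sum.inr x) / dualityMeasure C κ x) -
          dampedMatrix C κ (fun x y => n (Sum.inl (x, y)))).det) := by
  have hpos := dualityMeasure_pos hC hE
  have hP := subcritical_transitionMatrix hC hE
  have hm : Measurable fun v : (X × X) ⊕ X → ℝ≥0∞ => expNeg (∑ i, n i * v i) :=
    measurable_expNeg.comp (by fun_prop)
  rw [lintegral_jointLaw C κ hm]
  simp only [lintegral_networkDensity_mul_expNeg hC hE]
  rw [ENNReal.tsum_mul_left]
  have hD (x : X) : 1 ≤ 1 + (n (Sum.inr x) : ℝ) / dualityMeasure C κ x :=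
    le_add_of_nonneg_right (div_nonneg (by positivity) (hpos x).le)
  have hN0 (x y) : 0 ≤ dampedMatrix C κ (fun x y => n (Sum.inl (x, y))) x y :=
    mul_nonneg (hP.nonneg x y) (Real.exp_pos _).le
  have hsub : Subcritical (of fun x y => dampedMatrix C κ (fun x y => n (Sum.inl (x, y))) x y /
      (1 + n (Sum.inr x) / dualityMeasure C κ x)) := by
    refine hP.mono (fun x y => div_nonneg (hN0 x y) (zero_le_one.trans (hD x))) fun x y => ?_
    exact (div_le_self (hN0 x y) (hD x)).trans (mul_le_of_le_one_right (hP.nonneg x y)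
      (Real.exp_le_one_iff.2 (neg_nonpos.2 (NNReal.coe_nonneg _))))
  rw [tsum_subtype (balanced X) fun k => ENNReal.ofReal (networkWeight _ k)]
  change _ * balancedSum _ = _
  rw [balancedSum_eq hsub, det_diagonal_sub fun x => (zero_lt_one.trans_le (hD x)).ne',
    ← ENNReal.ofReal_mul (mul_nonneg hP.det_pos.le
      (Finset.prod_nonneg fun x _ => inv_nonneg.2 (zero_le_one.trans (hD x))))]
  congr 1
  rw [Finset.prod_inv_distrib, div_eq_mul_inv, mul_inv, mul_assoc]

/-! ### Identification of the joint law for the Poissonian ensemble -/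

variable {G : SimpleGraph X} {Ω : Type*} [MeasurableSpace Ω] {Pr : Measure Ω}
  {L : Ω → Measure (Loop G)}

/-- The numbers of jumps and the occupation field, listed together. -/
noncomputable def ensembleCoords (C : Sym2 X → ℝ) (κ : X → ℝ) (M : Measure (Loop G)) :
    (X × X) ⊕ X → ℝ≥0∞ :=
  Sum.elim (fun p => totalJumps M p.1 p.2) fun x => occupationField C κ M x

theorem measurable_ensembleCoords : Measurable (ensembleCoords (G := G) C κ) := by
  refine measurable_pi_lambda _ fun i => ?_
  rcases i with p | x
  · exact Measure.measurable_lintegral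
      ((measurable_of_countable _).comp (measurable_jumps p.1 p.2))
  · exact (Measure.measurable_lintegral (measurable_timeSpent x).ennreal_ofReal).div_const _

theorem lintegral_loopExponent (a : X → X → ℝ≥0) (b : X → ℝ≥0) (M : Measure (Loop G)) :
    ∫⁻ l, loopExponent C κ a b l ∂M =
      ∑ x, ∑ y, a x y * totalJumps M x y + ∑ x, b x * occupationField C κ M x := by
  have h1 (x y : X) : Measurable fun l : Loop G => (l.jumps x y : ℝ≥0∞) :=
    (measurable_of_countable _).comp (measurable_jumps x y)
  have h2 (x : X) : Measurable fun l : Loop G => ENNReal.ofReal (l.timeSpent x) :=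
    (measurable_timeSpent x).ennreal_ofReal
  simp only [loopExponent]
  rw [lintegral_add_left (Finset.measurable_sum _ fun x _ => Finset.measurable_sum _ fun y _ =>
    (h1 x y).const_mul _), lintegral_finsetSum _ fun x _ => Finset.measurable_sum _ fun y _ =>
    (h1 x y).const_mul _, lintegral_finsetSum _ fun x _ => ((h2 x).div_const _).const_mul _]
  congr 1
  · refine Finset.sum_congr rfl fun x _ => ?_
    rw [lintegral_finsetSum _ fun y _ => (h1 x y).const_mul _]
    exact Finset.sum_congr rfl fun y _ => lintegral_const_mul _ (h1 x y)
  · refine Finset.sum_congr rfl fun x _ => ?_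
    rw [lintegral_const_mul _ ((h2 x).div_const _)]
    simp only [div_eq_mul_inv]
    rw [lintegral_mul_const _ (h2 x), ← div_eq_mul_inv]
    rfl

/-- Campbell's theorem on one side and MacMahon's on the other give the same ratio of determinants
at every integer point. -/
theorem map_ensembleCoords_eq_jointLaw [IsProbabilityMeasure Pr] (hC : ∀ e, 0 ≤ C e)
    (hCG : ∀ e, e ∉ G.edgeSet → C e = 0) (hE : ∀ f : X → ℝ, f ≠ 0 → 0 < energy C κ f)
    (hL : IsPoissonianLoopEnsemble G C κ 1 L Pr) :
    Pr.map (fun ω => ensembleCoords C κ (L ω)) = jointLaw C κ := by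
  have hV : Measurable fun ω => ensembleCoords C κ (L ω) :=
    measurable_ensembleCoords.comp hL.measurable
  have key (n : (X × X) ⊕ X → ℕ) :
      ∫⁻ v, expNeg (∑ i, n i * v i) ∂Pr.map (fun ω => ensembleCoords C κ (L ω)) =
      ∫⁻ v, expNeg (∑ i, n i * v i) ∂jointLaw C κ := by
    have hm : Measurable fun v : (X × X) ⊕ X → ℝ≥0∞ => expNeg (∑ i, n i * v i) :=
      measurable_expNeg.comp (by fun_prop)
    rw [lintegral_expNeg_jointLaw hC hE, lintegral_map hm hV]
    let a : X → X → ℝ≥0 := fun x y => n (Sum.inl (x, y))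
    let b : X → ℝ≥0 := fun x => n (Sum.inr x)
    have hsum (ω : Ω) : ∑ i, n i * ensembleCoords C κ (L ω) i =
        ∫⁻ l, loopExponent C κ a b l ∂L ω := by
      rw [lintegral_loopExponent, Fintype.sum_sum_type, Fintype.sum_prod_type]
      rfl
    simp only [hsum]
    obtain ⟨h1, h2⟩ := expNeg_lintegral_loopMeasure hC hCG hE a b
    have hL' : IsPoissonProcess L (loopMeasure G C κ) Pr := by
      have := hL
      rwa [IsPoissonianLoopEnsemble, one_smul] at this
    rw [hL'.lintegral_expNeg (measurable_loopExponent a b) h1, h2]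
    rfl
  have : IsProbabilityMeasure (Pr.map fun ω => ensembleCoords C κ (L ω)) :=
    Measure.isProbabilityMeasure_map hV.aemeasurable
  -- At n = 0 the equality of Laplace transforms says that the candidate law has total mass 1.
  have : IsFiniteMeasure (jointLaw C κ) := by
    refine ⟨?_⟩
    have h0 := key 0
    simp only [Pi.zero_apply, Nat.cast_zero, zero_mul, Finset.sum_const_zero, expNeg_zero,
      lintegral_one, measure_univ] at h0
    rw [← h0]
    exact ENNReal.one_lt_top
  exact measure_ext_of_lintegral_expNeg key

end JointLaw


/-! ### Summation over the networks inducing a given flow -/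

theorem tsum_prod_eq_prod_tsum {ι : Type*} [Fintype ι] (f : ι → ℕ → ℝ≥0∞) :
    ∑' m : ι → ℕ, ∏ i, f i (m i) = ∏ i, ∑' j, f i j := by
  have hfin (n : ℕ) (g : Fin n → ℕ → ℝ≥0∞) :
      ∑' m : Fin n → ℕ, ∏ i, g i (m i) = ∏ i, ∑' j, g i j := by
    induction n with
    | zero => simp
    | succ n ih =>
      rw [← (Fin.consEquiv fun _ : Fin (n + 1) => ℕ).tsum_eq, ENNReal.tsum_prod',
        Fin.prod_univ_succ, ← ih, ← ENNReal.tsum_mul_right]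
      refine tsum_congr fun j => ?_
      rw [← ENNReal.tsum_mul_left]
      refine tsum_congr fun m => ?_
      rw [Fin.prod_univ_succ]
      rfl
  let e := (Fintype.equivFin ι).symm
  rw [← e.prod_comp, ← hfin, ← (e.symm.arrowCongr (Equiv.refl ℕ)).tsum_eq]
  refine tsum_congr fun m => ?_
  rw [← e.prod_comp]
  rfl

/-- At integer order the Gamma values are factorials and the real powers are natural powers,
including 0^0 = 1. Termwise comparison with an exponential series in z² gives summability. -/
theorem hasSum_besselI (H : ℕ) {z : ℝ} (hz : 0 ≤ z) :
    HasSum (fun j : ℕ => z ^ (2 * j + H) / (j.factorial * (j + H).factorial : ℝ))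
      (besselI H (2 * z)) := by
  have hterm (j : ℕ) : 1 / ((j.factorial : ℝ) * Real.Gamma (H + j + 1)) *
      (2 * z / 2) ^ (2 * (j : ℝ) + H) =
      z ^ (2 * j + H) / (j.factorial * (j + H).factorial : ℝ) := by
    rw [show ((H : ℝ) + j + 1) = ((j + H : ℕ) : ℝ) + 1 by push_cast; ring,
      Real.Gamma_nat_eq_factorial, mul_div_cancel_left₀ _ (two_ne_zero' ℝ),
      show 2 * (j : ℝ) + H = ((2 * j + H : ℕ) : ℝ) by push_cast; ring, Real.rpow_natCast]
    ring
  have hsum : Summable fun j : ℕ => z ^ (2 * j + H) / (j.factorial * (j + H).factorial : ℝ) := by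
    refine Summable.of_nonneg_of_le (fun j => by positivity) (fun j => ?_)
      ((Real.summable_pow_div_factorial (z ^ 2)).mul_left (z ^ H))
    rw [pow_add, pow_mul, mul_comm, mul_div_assoc]
    refine mul_le_mul_of_nonneg_left (div_le_div_of_nonneg_left (by positivity) (by positivity) ?_)
      (by positivity)
    exact le_mul_of_one_le_right (by positivity)
      (Nat.one_le_cast.2 (Nat.factorial_pos _))
  rw [besselI]
  simp only [hterm]
  exact hsum.hasSum

/-- Each edge is the image of exactly two ordered pairs, which are distinct because the graph has no
loop-edges. -/
theorem prod_prod_eq_prod_edgeFinset {X : Type*} [Fintype X] [DecidableEq X] (G : SimpleGraph X)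
    [DecidableRel G.Adj] (F : X → X → ℝ) (hF : ∀ x y, ¬ G.Adj x y → F x y = 1) :
    ∏ x, ∏ y, F x y =
      ∏ e ∈ G.edgeFinset, Sym2.lift ⟨fun x y => F x y * F y x, fun _ _ => mul_comm _ _⟩ e := by
  rw [← Fintype.prod_prod_type', ← Finset.prod_filter_of_ne (p := fun p : X × X => G.Adj p.1 p.2)
    fun p _ hp => not_not.1 fun h => hp (hF _ _ h),
    ← Finset.prod_fiberwise_of_maps_to (t := G.edgeFinset) (g := fun p : X × X => s(p.1, p.2))
      fun p hp => by simpa using hp]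
  refine Finset.prod_congr rfl fun e he => ?_
  induction e with
  | h x y =>
    have hadj : G.Adj x y := by simpa using he
    have : (Finset.univ.filter fun p : X × X => G.Adj p.1 p.2).filter
        (fun p => s(p.1, p.2) = s(x, y)) = {(x, y), (y, x)} := by
      ext ⟨u, v⟩
      simp only [Finset.mem_filter, Finset.mem_univ, true_and, Sym2.eq_iff, Finset.mem_insert,
        Finset.mem_singleton, Prod.mk.injEq]
      constructor
      · exact fun h => h.2
      · rintro (⟨rfl, rfl⟩ | ⟨rfl, rfl⟩)
        · exact ⟨hadj, Or.inl ⟨rfl, rfl⟩⟩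
        · exact ⟨hadj.symm, Or.inr ⟨rfl, rfl⟩⟩
    rw [this, Finset.prod_pair (by simp [hadj.ne])]
    rfl

section Flow

open Matrix

variable {X : Type*}

/-- The subtraction on the right is truncated, and so it encodes the positive part. -/
theorem inducedFlow_antisymmPart_eq (k : X → X → ℕ) (x y : X) :
    inducedFlow (antisymmPart k) x y = k x y - k y x := by
  unfold inducedFlow antisymmPart
  split_ifs <;> omega

variable [Fintype X] {G : SimpleGraph X} {C : Sym2 X → ℝ} {κ : X → ℝ}

/-- By balance, one factor √ρ_x can be charged to each jump out of x and the other to each jump into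
x. -/
theorem prod_pow_sum_of_balanced {k : X → X → ℕ} (hk : k ∈ balanced X) {ρ : X → ℝ}
    (hρ : ∀ x, 0 ≤ ρ x) :
    ∏ x, ρ x ^ (∑ y, k x y) = ∏ x, ∏ y, (√(ρ x) * √(ρ y)) ^ k x y := by
  simp only [mul_pow, Finset.prod_mul_distrib]
  rw [Finset.prod_comm (f := fun x y => √(ρ y) ^ k x y), ← Finset.prod_mul_distrib]
  refine Finset.prod_congr rfl fun x _ => ?_
  rw [Finset.prod_pow_eq_pow_sum, Finset.prod_pow_eq_pow_sum, ← hk x, ← mul_pow,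
    Real.mul_self_sqrt (hρ x)]

theorem IsFlow.mul_eq_zero {h : X → X → ℕ} (hh : IsFlow G h) (x y : X) :
    h x y = 0 ∨ h y x = 0 := by
  by_cases hxy : G.Adj x y
  · exact Nat.mul_eq_zero.1 (hh.oriented x y hxy)
  · exact Or.inl (hh.eq_zero x y hxy)

section Density

variable [DecidableEq X]

theorem networkDensity_eq_of_balanced {k : X → X → ℕ} (hk : k ∈ balanced X) {ρ : X → ℝ}
    (hρ : ∀ x, 0 ≤ ρ x) :
    networkDensity C κ k ρ = (1 - transitionMatrix C κ).det *
      (∏ x, ∏ y, (√(ρ x) * C s(x, y) * √(ρ y)) ^ k x y / (k x y).factorial) *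
      ∏ x, dualityMeasure C κ x * Real.exp (-(dualityMeasure C κ x * ρ x)) := by
  have h : ∏ x, ∏ y, (√(ρ x) * C s(x, y) * √(ρ y)) ^ k x y / ((k x y).factorial : ℝ) =
      (∏ x, ∏ y, C s(x, y) ^ k x y / ((k x y).factorial : ℝ)) * ∏ x, ρ x ^ (∑ y, k x y) := by
    rw [prod_pow_sum_of_balanced hk hρ, ← Finset.prod_mul_distrib]
    refine Finset.prod_congr rfl fun x _ => ?_
    rw [← Finset.prod_mul_distrib]
    refine Finset.prod_congr rfl fun y _ => ?_
    rw [mul_right_comm, mul_pow]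
    ring
  rw [networkDensity, h, Finset.prod_mul_distrib]
  ring

theorem networkDensity_eq_zero (hCG : ∀ e, e ∉ G.edgeSet → C e = 0) {k : X → X → ℕ} {x y : X}
    (hxy : ¬ G.Adj x y) (hk : k x y ≠ 0) (ρ : X → ℝ) : networkDensity C κ k ρ = 0 := by
  have : ∏ x, ∏ y, C s(x, y) ^ k x y / ((k x y).factorial : ℝ) = 0 := by
    refine Finset.prod_eq_zero (Finset.mem_univ x) (Finset.prod_eq_zero (Finset.mem_univ y) ?_)
    rw [hCG _ hxy, zero_pow hk, zero_div]
  rw [networkDensity, this, mul_zero, zero_mul]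

end Density

variable [DecidableRel G.Adj]

/-- The network obtained from `h` by adding `m e` crossings of every edge `e` in each direction. -/
def addCrossings (h : X → X → ℕ) (m : G.edgeFinset → ℕ) (x y : X) : ℕ :=
  if hxy : G.Adj x y then h x y + m ⟨s(x, y), by simpa using hxy⟩ else 0

theorem addCrossings_of_adj (h : X → X → ℕ) (m : G.edgeFinset → ℕ) {x y : X} (hxy : G.Adj x y) :
    addCrossings h m x y = h x y + m ⟨s(x, y), by simpa using hxy⟩ := dif_pos hxy

theorem addCrossings_of_not_adj (h : X → X → ℕ) (m : G.edgeFinset → ℕ) {x y : X}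
    (hxy : ¬ G.Adj x y) : addCrossings h m x y = 0 := dif_neg hxy

theorem addCrossings_injective (h : X → X → ℕ) :
    Function.Injective (addCrossings (G := G) h) := by
  intro m m' hm
  funext ⟨e, he⟩
  induction e with
  | h x y =>
    have hadj : G.Adj x y := by simpa using he
    have := congrFun (congrFun hm x) y
    rw [addCrossings_of_adj h m hadj, addCrossings_of_adj h m' hadj] at this
    exact Nat.add_left_cancel this

theorem addCrossings_mem_balanced {h : X → X → ℕ} (hh : IsFlow G h) (m : G.edgeFinset → ℕ) :
    addCrossings h m ∈ balanced X := by
  have h0 (x y : X) : addCrossings h m x y = h x y + addCrossings (G := G) 0 m x y := by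
    by_cases hxy : G.Adj x y
    · rw [addCrossings_of_adj h m hxy, addCrossings_of_adj 0 m hxy]
      simp
    · rw [addCrossings_of_not_adj h m hxy, addCrossings_of_not_adj 0 m hxy, hh.eq_zero x y hxy]
  have hsymm (x y : X) : addCrossings (G := G) 0 m x y = addCrossings (G := G) 0 m y x := by
    by_cases hxy : G.Adj x y
    · rw [addCrossings_of_adj 0 m hxy, addCrossings_of_adj 0 m hxy.symm]
      simp only [Pi.zero_apply, zero_add]
      congr 2
      exact Sym2.eq_swap
    · rw [addCrossings_of_not_adj 0 m hxy, addCrossings_of_not_adj 0 m fun h => hxy h.symm]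
  intro x
  simp only [h0, Finset.sum_add_distrib, hh.balance x]
  congr 1
  exact Finset.sum_congr rfl fun y _ => hsymm x y

theorem inducedFlow_addCrossings {h : X → X → ℕ} (hh : IsFlow G h) (m : G.edgeFinset → ℕ) :
    inducedFlow (antisymmPart (addCrossings h m)) = h := by
  funext x y
  rw [inducedFlow_antisymmPart_eq]
  by_cases hxy : G.Adj x y
  · have : (⟨s(x, y), by simpa using hxy⟩ : G.edgeFinset) =
        ⟨s(y, x), by simpa using hxy.symm⟩ := Subtype.ext Sym2.eq_swap
    rw [addCrossings_of_adj h m hxy, addCrossings_of_adj h m hxy.symm, this]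
    have := hh.mul_eq_zero x y
    omega
  · rw [addCrossings_of_not_adj h m hxy, hh.eq_zero x y hxy, Nat.zero_sub]

/-- The number of crossings removed in both directions is min(k_{x,y}, k_{y,x}). What is left of k
is its induced flow. -/
theorem exists_addCrossings_eq {h k : X → X → ℕ} (hk : ∀ x y, ¬ G.Adj x y → k x y = 0)
    (hkh : inducedFlow (antisymmPart k) = h) : ∃ m : G.edgeFinset → ℕ, addCrossings h m = k := by
  refine ⟨fun e => Sym2.lift ⟨fun x y => min (k x y) (k y x), fun _ _ => min_comm _ _⟩ e.1, ?_⟩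
  funext x y
  by_cases hxy : G.Adj x y
  · rw [addCrossings_of_adj _ _ hxy, ← hkh, inducedFlow_antisymmPart_eq]
    simp only [Sym2.lift_mk]
    omega
  · rw [addCrossings_of_not_adj _ _ hxy, hk x y hxy]

variable [DecidableEq X]

/-- Networks of nonzero density inducing h are parametrised by free integers m_e, one per edge. The
density is a product over edges in these integers, so the sum is a product of Bessel series. -/
theorem tsum_networkDensity_eq_flowDensity (hC : ∀ e, 0 ≤ C e)
    (hCG : ∀ e, e ∉ G.edgeSet → C e = 0) (hE : ∀ f : X → ℝ, f ≠ 0 → 0 < energy C κ f)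
    {h : X → X → ℕ} (hh : IsFlow G h) {ρ : X → ℝ} (hρ : ∀ x, 0 ≤ ρ x) :
    ∑' k : balanced X, (if inducedFlow (antisymmPart k.1) = h then
      ENNReal.ofReal (networkDensity C κ k ρ) else 0) = ENNReal.ofReal (flowDensity G C κ h ρ) := by
  have hpos := dualityMeasure_pos hC hE
  have hdet := (subcritical_transitionMatrix hC hE).det_pos
  let g : (X → X → ℕ) → ℝ≥0∞ := fun k => if inducedFlow (antisymmPart k) = h then
      ENNReal.ofReal (networkDensity C κ k ρ) else 0
  let c : ℝ := (1 - transitionMatrix C κ).det *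
    ∏ x, dualityMeasure C κ x * Real.exp (-(dualityMeasure C κ x * ρ x))
  have hc : 0 ≤ c := mul_nonneg hdet.le
    (Finset.prod_nonneg fun x _ => mul_nonneg (hpos x).le (Real.exp_pos _).le)
  let z : X → X → ℝ := fun x y => √(ρ x) * C s(x, y) * √(ρ y)
  have hz (x y : X) : 0 ≤ z x y := mul_nonneg (mul_nonneg (Real.sqrt_nonneg _) (hC _))
    (Real.sqrt_nonneg _)
  have hzs (x y : X) : z x y = z y x := by
    simp only [z]
    rw [Sym2.eq_swap]
    ring
  let t : Sym2 X → ℕ → ℝ := fun e j => Sym2.lift ⟨fun x y =>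
    z x y ^ (2 * j + max (h x y) (h y x)) /
      (j.factorial * (j + max (h x y) (h y x)).factorial : ℝ), fun x y => by
        dsimp only
        rw [hzs x y, max_comm]⟩ e
  have ht (e : Sym2 X) : HasSum (t e) (besselFactor C h ρ e) := by
    induction e with
    | h x y => exact hasSum_besselI _ (hz x y)
  have ht0 (e : Sym2 X) (j : ℕ) : 0 ≤ t e j := by
    induction e with
    | h x y =>
      have := hz x y
      change (0 : ℝ) ≤ z x y ^ (2 * j + max (h x y) (h y x)) /
        (j.factorial * (j + max (h x y) (h y x)).factorial : ℝ)
      positivity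
  have hterm (m : G.edgeFinset → ℕ) : (balanced X).indicator g (addCrossings h m) =
      ENNReal.ofReal c * ∏ e, ENNReal.ofReal (t e.1 (m e)) := by
    rw [Set.indicator_of_mem (addCrossings_mem_balanced hh m)]
    simp only [g]
    rw [if_pos (inducedFlow_addCrossings hh m), networkDensity_eq_of_balanced
      (addCrossings_mem_balanced hh m) hρ, prod_prod_eq_prod_edgeFinset G _ fun x y hxy => by
        rw [addCrossings_of_not_adj h m hxy]; simp,
      ← Finset.prod_coe_sort, ← ENNReal.ofReal_prod_of_nonneg fun e _ => ht0 _ _,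
      ← ENNReal.ofReal_mul hc, mul_right_comm]
    congr 2
    refine Finset.prod_congr rfl fun ⟨e, he⟩ _ => ?_
    induction e with
    | h x y =>
      have hadj : G.Adj x y := by simpa using he
      have hswap : (⟨s(y, x), by simpa using hadj.symm⟩ : G.edgeFinset) = ⟨s(x, y), he⟩ :=
        Subtype.ext Sym2.eq_swap
      simp only [Sym2.lift_mk, t]
      rw [addCrossings_of_adj h m hadj, addCrossings_of_adj h m hadj.symm, hswap]
      generalize m ⟨s(x, y), he⟩ = j
      change z x y ^ _ / _ * (z y x ^ _ / _) = _
      rw [hzs y x, div_mul_div_comm, ← pow_add]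
      -- One orientation carries j jumps and the other j + H, with H = max(h_{x,y}, h_{y,x}). This
      -- gives the power 2j + H and the factorials of the Bessel series.
      rcases hh.mul_eq_zero x y with h0 | h0
      · rw [h0, Nat.zero_max, zero_add, add_comm (h y x) j, two_mul, add_assoc]
      · rw [h0, Nat.max_zero, zero_add, add_comm (h x y) j, two_mul, add_right_comm, mul_comm
          ((j + h x y).factorial : ℝ)]
  -- Balanced networks inducing h but charging a non-edge have zero density, so they drop out of the
  -- sum.
  have hsupp : Function.support ((balanced X).indicator g) ⊆ Set.range (addCrossings (G := G) h) := by
    intro k hk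
    have hk' := Set.mem_of_indicator_ne_zero hk
    rw [Function.mem_support, Set.indicator_of_mem hk'] at hk
    have hflow : inducedFlow (antisymmPart k) = h := by
      by_contra hne
      exact hk (if_neg hne)
    refine exists_addCrossings_eq (fun x y hxy => ?_) hflow
    by_contra hne
    refine hk ?_
    simp only [g]
    rw [networkDensity_eq_zero hCG hxy hne, ENNReal.ofReal_zero, ite_self]
  rw [show ∑' k : balanced X, (if inducedFlow (antisymmPart k.1) = h then
      ENNReal.ofReal (networkDensity C κ k ρ) else 0) = ∑' k, (balanced X).indicator g k from
    tsum_subtype (balanced X) g, ← (addCrossings_injective h).tsum_eq hsupp]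
  simp only [hterm]
  rw [ENNReal.tsum_mul_left, tsum_prod_eq_prod_tsum fun (e : G.edgeFinset) j =>
    ENNReal.ofReal (t e.1 j)]
  simp only [← ENNReal.ofReal_tsum_of_nonneg (ht0 _) (ht _).summable, (ht _).tsum_eq]
  rw [Finset.prod_coe_sort G.edgeFinset fun e => ENNReal.ofReal (besselFactor C h ρ e),
    ← ENNReal.ofReal_prod_of_nonneg fun e _ => (ht e).nonneg (ht0 e), ← ENNReal.ofReal_mul hc]
  congr 1
  rw [flowDensity, mul_right_comm]

end Flow


/-! ### Almost sure properties and the law of the induced flow -/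

section LoopEnsembleLaw

variable {X : Type*} [Fintype X] [DecidableEq X] {G : SimpleGraph X}
  {C : Sym2 X → ℝ} {κ : X → ℝ} {Ω : Type*} [MeasurableSpace Ω]
  {Pr : Measure Ω} [IsProbabilityMeasure Pr] {L : Ω → Measure (Loop G)}

/-- All of this holds almost everywhere for `jointLaw`, whose components carry a fixed balanced
network and finite occupation values. A component whose network charges a non-edge is the zero
measure. -/
theorem ae_ensembleCoords (hC : ∀ e, 0 ≤ C e)
    (hCG : ∀ e, e ∉ G.edgeSet → C e = 0) (hE : ∀ f : X → ℝ, f ≠ 0 → 0 < energy C κ f)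
    (hL : IsPoissonianLoopEnsemble G C κ 1 L Pr) :
    ∀ᵐ ω ∂Pr, ∃ k ∈ balanced X, (∀ x y, ¬ G.Adj x y → k x y = 0) ∧
      (∀ x y, totalJumps (L ω) x y = (k x y : ℝ≥0∞)) ∧ ∀ x, occupationField C κ (L ω) x ≠ ∞ := by
  let S (k : X → X → ℕ) : Set ((X × X) ⊕ X → ℝ≥0∞) :=
    (⋂ p : X × X, (fun v => v (Sum.inl p)) ⁻¹' {(k p.1 p.2 : ℝ≥0∞)}) ∩
      ⋂ x : X, (fun v => v (Sum.inr x)) ⁻¹' {∞}ᶜ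
  have hSm (k) : MeasurableSet (S k) := .inter
    (.iInter fun p => measurable_pi_apply (Sum.inl p) (measurableSet_singleton _))
    (.iInter fun x => measurable_pi_apply (Sum.inr x) (measurableSet_singleton _).compl)
  let T : Set ((X × X) ⊕ X → ℝ≥0∞) :=
    ⋃ k ∈ {k : X → X → ℕ | k ∈ balanced X ∧ ∀ x y, ¬ G.Adj x y → k x y = 0}, S k
  have hTm : MeasurableSet T := MeasurableSet.biUnion (Set.to_countable _) fun k _ => hSm k
  have hT : ∀ᵐ v ∂jointLaw C κ, v ∈ T := by
    rw [jointLaw, Measure.ae_sum_iff]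
    rintro ⟨k, hk⟩
    rw [ae_map_iff (p := fun v => v ∈ T) (measurable_coords k).aemeasurable (by simpa using hTm)]
    by_cases hkG : ∀ x y, ¬ G.Adj x y → k x y = 0
    · refine .of_forall fun ρ => Set.mem_biUnion (x := k) ⟨hk, hkG⟩
        ⟨Set.mem_iInter.2 fun p => rfl, Set.mem_iInter.2 fun x => ?_⟩
      exact ENNReal.ofReal_ne_top
    · push Not at hkG
      obtain ⟨x, y, hxy, hne⟩ := hkG
      have : (fun ρ : X → ℝ => ENNReal.ofReal (networkDensity C κ k ρ)) = 0 := by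
        funext ρ
        rw [networkDensity_eq_zero hCG hxy hne, ENNReal.ofReal_zero, Pi.zero_apply]
      simp only [this, withDensity_zero]
      rw [ae_zero]
      exact Filter.eventually_bot
  rw [← map_ensembleCoords_eq_jointLaw hC hCG hE hL] at hT
  filter_upwards [ae_of_ae_map
    (measurable_ensembleCoords.comp hL.measurable).aemeasurable hT] with ω hω
  obtain ⟨k, hk, h1, h2⟩ := Set.mem_iUnion₂.1 hω
  exact ⟨k, hk.1, hk.2, fun x y => Set.mem_iInter.1 h1 (x, y), fun x => Set.mem_iInter.1 h2 x⟩

theorem ae_network (hC : ∀ e, 0 ≤ C e)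
    (hCG : ∀ e, e ∉ G.edgeSet → C e = 0) (hE : ∀ f : X → ℝ, f ≠ 0 → 0 < energy C κ f)
    (hL : IsPoissonianLoopEnsemble G C κ 1 L Pr) :
    ∀ᵐ ω ∂Pr, (∀ x y, totalJumps (L ω) x y = (network (L ω) x y : ℝ≥0∞)) ∧
      IsEulerian G (network (L ω)) ∧ ∀ x, occupationField C κ (L ω) x ≠ ∞ := by
  filter_upwards [ae_ensembleCoords hC hCG hE hL] with ω ⟨k, hk, hkG, h1, h2⟩
  have hnet : network (L ω) = k := by
    funext x y
    rw [network, h1, ENNReal.toReal_natCast, Nat.floor_natCast]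
  rw [hnet]
  exact ⟨h1, ⟨hkG, hk⟩, h2⟩

theorem measure_inducedFlow_inter [DecidableRel G.Adj] (hC : ∀ e, 0 ≤ C e)
    (hCG : ∀ e, e ∉ G.edgeSet → C e = 0) (hE : ∀ f : X → ℝ, f ≠ 0 → 0 < energy C κ f)
    (hL : IsPoissonianLoopEnsemble G C κ 1 L Pr) {h : X → X → ℕ} (hh : IsFlow G h)
    {B : Set (X → ℝ)} (hB : MeasurableSet B) :
    Pr {ω | inducedFlow (antisymmPart (network (L ω))) = h ∧
        (fun x => (occupationField C κ (L ω) x).toReal) ∈ B} =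
      ∫⁻ ρ in B ∩ {ρ | ∀ x, 0 ≤ ρ x}, ENNReal.ofReal (flowDensity G C κ h ρ) := by
  let S : Set ((X × X) ⊕ X → ℝ≥0∞) :=
    {v | inducedFlow (antisymmPart fun x y => ⌊(v (Sum.inl (x, y))).toReal⌋₊) = h} ∩
      {v | (fun x => (v (Sum.inr x)).toReal) ∈ B}
  have hS : MeasurableSet S := by
    refine .inter ?_ ?_
    · have hm : Measurable fun (v : (X × X) ⊕ X → ℝ≥0∞) (x y : X) =>
          ⌊(v (Sum.inl (x, y))).toReal⌋₊ :=
        measurable_pi_lambda _ fun x => measurable_pi_lambda _ fun y =>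
          Nat.measurable_floor.comp (measurable_pi_apply _).ennreal_toReal
      -- There are countably many networks, so every set of networks is measurable.
      exact hm (Set.to_countable {k : X → X → ℕ | inducedFlow (antisymmPart k) = h}).measurableSet
    · exact (measurable_pi_lambda _ fun x => (measurable_pi_apply _).ennreal_toReal) hB
  have hV : Measurable fun ω => ensembleCoords C κ (L ω) :=
    measurable_ensembleCoords.comp hL.measurable
  have hm (k : balanced X) : AEMeasurable (fun ρ => ENNReal.ofReal (networkDensity C κ k ρ) *
      S.indicator 1 (coords k.1 ρ)) (volume.restrict {ρ : X → ℝ | ∀ x, 0 ≤ ρ x}) :=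
    ((measurable_networkDensity C κ k).ennreal_ofReal.mul
      ((measurable_one.indicator hS).comp (measurable_coords k.1))).aemeasurable
  change Pr ((fun ω => ensembleCoords C κ (L ω)) ⁻¹' S) = _
  rw [← Measure.map_apply hV hS, map_ensembleCoords_eq_jointLaw hC hCG hE hL,
    ← lintegral_indicator_one hS, lintegral_jointLaw C κ (measurable_one.indicator hS),
    ← lintegral_tsum hm, ← Measure.restrict_restrict hB, ← lintegral_indicator hB]
  refine setLIntegral_congr_fun measurableSet_nonneg fun ρ hρ => ?_
  -- On nonnegative ρ the floor and `toReal` recover k and ρ exactly, so the event selects the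
  -- networks inducing h and the fields in B.
  have hmem (k : X → X → ℕ) :
      coords k ρ ∈ S ↔ inducedFlow (antisymmPart k) = h ∧ ρ ∈ B := by
    have e1 : (fun x y => ⌊(coords k ρ (Sum.inl (x, y))).toReal⌋₊) = k := by
      funext x y
      simp [coords]
    have e2 : (fun x => (coords k ρ (Sum.inr x)).toReal) = ρ := by
      funext x
      exact ENNReal.toReal_ofReal (hρ x)
    change inducedFlow (antisymmPart fun x y => ⌊(coords k ρ (Sum.inl (x, y))).toReal⌋₊) = h ∧
      (fun x => (coords k ρ (Sum.inr x)).toReal) ∈ B ↔ _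
    rw [e1, e2]
  by_cases hρB : ρ ∈ B
  · rw [Set.indicator_of_mem hρB, ← tsum_networkDensity_eq_flowDensity hC hCG hE hh hρ]
    refine tsum_congr fun k => ?_
    by_cases hk : inducedFlow (antisymmPart k.1) = h
    · rw [if_pos hk, Set.indicator_of_mem ((hmem k.1).2 ⟨hk, hρB⟩), Pi.one_apply, mul_one]
    · rw [if_neg hk, Set.indicator_of_notMem fun h' => hk ((hmem k.1).1 h').1, mul_zero]
  · rw [Set.indicator_of_notMem hρB, ENNReal.tsum_eq_zero]
    intro k
    rw [Set.indicator_of_notMem fun h' => hρB ((hmem k.1).1 h').2, mul_zero]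

end LoopEnsembleLaw

end LoopEnsemble

theorem mainTheorem5 {X : Type*} [Fintype X] [DecidableEq X]
    (G : SimpleGraph X) [DecidableRel G.Adj] (hG : G.Connected)
    (C : Sym2 X → ℝ) (hC : ∀ e, 0 ≤ C e) (hCG : ∀ e, e ∉ G.edgeSet → C e = 0)
    (κ : X → ℝ) (hκ : ∀ x, 0 ≤ κ x)
    (hE : ∀ f : X → ℝ, f ≠ 0 → 0 < LoopEnsemble.energy C κ f)
    {Ω : Type*} [MeasurableSpace Ω] (Pr : Measure Ω) [IsProbabilityMeasure Pr]
    (L : Ω → Measure (LoopEnsemble.Loop G))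
    (hL : LoopEnsemble.IsPoissonianLoopEnsemble G C κ 1 L Pr) :
    (∀ᵐ ω ∂Pr,
      (∀ x y, LoopEnsemble.totalJumps (L ω) x y = (LoopEnsemble.network (L ω) x y : ℝ≥0∞)) ∧
      LoopEnsemble.IsEulerian G (LoopEnsemble.network (L ω)) ∧
      ∀ x, LoopEnsemble.occupationField C κ (L ω) x ≠ ∞) ∧
    ∀ h : X → X → ℕ, LoopEnsemble.IsFlow G h →
      ∀ B : Set (X → ℝ), MeasurableSet B →
        Pr {ω | LoopEnsemble.inducedFlow
                (LoopEnsemble.antisymmPart (LoopEnsemble.network (L ω))) = h ∧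
              (fun x => (LoopEnsemble.occupationField C κ (L ω) x).toReal) ∈ B} =
          ∫⁻ ρ in B ∩ {ρ | ∀ x, 0 ≤ ρ x},
            ENNReal.ofReal (LoopEnsemble.flowDensity G C κ h ρ) := by
  exact ⟨LoopEnsemble.ae_network hC hCG hE hL, fun h hh B hB =>
    LoopEnsemble.measure_inducedFlow_inter hC hCG hE hL hh hB⟩
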